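/- Let $F$ be the Fourier transform $F(u)(\xi)=\int_{\mathbb R^n}e^{-2\pi i\xi\cdot x}u(x)\,dx$, extended to a unitary operator on $L^2(\mathbb R^n)$. For $\psi\in L^\infty(\mathbb R^n)$ and for continuous compactly supported $\Phi$ on $\mathbb R^n$ let $A_\psi$, $B_\Phi$ be the bounded operators on $L^2(\mathbb R^n)$ given by $F(A_\psi u)=\psi F(u)$ and $B_\Phi u=\Phi u$. Let $A\subset L^\infty(\mathbb R^n)$ be the algebra of all $\psi$ such that the commutator $[A_\psi,B_\Phi]$ is compact for every such $\Phi$, let $A_0\subset A$ be the closed ideal of those $\psi$ with $\operatorname{ess\,lim}_{|\xi|\to\infty}\psi(\xi)=0$, and let $\mathfrak S$ be the spectrum (the space of characters) of the commutative Banach algebra $\mathcal A=A/A_0$; write $\hat\psi(\eta)$ for the value of $\eta\in\mathfrak S$ on the class of $\psi\in A$. For a linear subspace $X\subset\mathbb R^n$ and $\xi\in\mathbb R^n$ write $\tilde\xi$, $\bar\xi$ for the orthogonal projections of $\xi$ on $X$, $X^\perp$. Let $S_X=\{\xi\in\mathbb R^n : |\tilde\xi|^2+|\bar\xi|^4=1\}$,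 and define $\pi_X:\mathbb R^n\setminus\{0\}\to S_X$ by $$\pi_X(\xi)=\frac{\tilde\xi}{(|\tilde\xi|^2+|\bar\xi|^4)^{1/2}}+\frac{\bar\xi}{(|\tilde\xi|^2+|\bar\xi|^4)^{1/4}} .$$ For every $\psi\in C(S_X)$ the function $\psi\circ\pi_X$ belongs to $A$, and for every $\eta\in\mathfrak S$ there is a unique point $p_X(\eta)\in S_X$ such that $\widehat{\psi\circ\pi_X}(\eta)=\psi(p_X(\eta))$ for all $\psi\in C(S_X)$ (that is, $p_X:\mathfrak S\to S_X$ is the projection of spectra dual to the embedding of $A_X=\{\psi\circ\pi_X:\psi\in C(S_X)\}$ into $\mathcal A$). Let $\eta\in\mathfrak S$ and, for every linear subspace $X\subset\mathbb R^n$, write $p_X(\eta)=\tilde\xi_X+\bar\xi_X$ with $\tilde\xi_X\in X$, $\bar\xi_X\in X^\perp$. For vectors $u,v$, write $u\upuparrows v$ if they are nonzero and $u=cv$ for some $c>0$. Then there exist a unique (ordered) orthonormal system $\zeta_1,\dots,\zeta_m$ in $\mathbb R^n$ and a unique integer $d\in\{m-1,m\}$, $d\ge 0$, such that for all linear subspaces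 $X\subset\mathbb R^n$: (i) $\tilde\xi_X\neq0$ if and only if $X\supset\operatorname{span}(\zeta_1,\dots,\zeta_d)$; moreover, if $\tilde\xi_X\ne0$, then $m\ge 1$ and $\tilde\xi_X\upuparrows\zeta_1$; (ii) $\bar\xi_X\neq0$ if and only if $X\not\supset\operatorname{span}(\zeta_1,\dots,\zeta_m)$; moreover, if $\bar\xi_X\neq0$, then $\bar\xi_X\upuparrows\operatorname{pr}_{X^\perp}\zeta_{k(X)}$, where $k(X)=\min\{k\in\{1,\dots,m\} : \zeta_k\notin X\}$ and $\operatorname{pr}_{X^\perp}$ is the orthogonal projection on $X^\perp$. -/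

import Mathlib

open MeasureTheory
open scoped ENNReal

noncomputable section

namespace HSymbol

/-- The space `ℝⁿ` with its Euclidean norm and inner product. -/
abbrev Rn (n : ℕ) : Type := EuclideanSpace ℝ (Fin n)

/-- The complex Hilbert space `L²(ℝⁿ)`. -/
abbrev L2 (n : ℕ) : Type := Lp ℂ 2 (volume : Measure (Rn n))

/-- The Banach space `L^∞(ℝⁿ)` of (a.e. classes of) essentially bounded measurable functions,
with the norm `ess sup |f|`. -/
abbrev Linf (n : ℕ) : Type := Lp ℂ ∞ (volume : Measure (Rn n))

/-- Pointwise multiplication on `L^∞(ℝⁿ)`. -/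
instance instMulLinf (n : ℕ) : Mul (Linf n) where
  mul f g := ⟨f.1 * g.1, (Lp.mem_Lp_iff_memLp).2
    ((MemLp.mul (r := ∞) (Lp.memLp g) (Lp.memLp f)).ae_eq (AEEqFun.coeFn_mul f.1 g.1).symm)⟩

/-- The constant function `1` in `L^∞(ℝⁿ)`. -/
instance instOneLinf (n : ℕ) : One (Linf n) where
  one := ⟨1, (Lp.mem_Lp_iff_memLp).2
    ((memLp_top_const (1 : ℂ)).ae_eq (AEEqFun.coeFn_one (α := Rn n) (β := ℂ)).symm)⟩

lemma Linf.coeFn_mul {n : ℕ} (f g : Linf n) :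
    ((f * g : Linf n) : Rn n → ℂ) =ᵐ[volume] fun ξ => f ξ * g ξ :=
  AEEqFun.coeFn_mul f.1 g.1

lemma Linf.coeFn_one {n : ℕ} : ((1 : Linf n) : Rn n → ℂ) =ᵐ[volume] fun _ => 1 :=
  AEEqFun.coeFn_one

lemma Linf.ae_norm_le {n : ℕ} (f : Linf n) : ∀ᵐ ξ : Rn n, ‖f ξ‖ ≤ ‖f‖ := by
  filter_upwards [ae_le_eLpNormEssSup (f := (f : Rn n → ℂ)) (μ := volume)] with ξ h
  rw [Lp.norm_def, eLpNorm_exponent_top]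
  have h1 : eLpNormEssSup (f : Rn n → ℂ) volume ≠ ∞ := by
    rw [← eLpNorm_exponent_top]
    exact Lp.eLpNorm_ne_top f
  simpa using ENNReal.toReal_mono h1 h

lemma Linf.norm_le {n : ℕ} (f : Linf n) {C : ℝ} (hC : 0 ≤ C)
    (h : ∀ᵐ ξ : Rn n, ‖f ξ‖ ≤ C) : ‖f‖ ≤ C := by
  rw [Lp.norm_def, eLpNorm_exponent_top]
  refine ENNReal.toReal_le_of_le_ofReal hC (eLpNormEssSup_le_of_ae_bound h)

/-- `L^∞(ℝⁿ)` is a commutative unital Banach algebra under pointwise operations. -/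
instance instNormedCommRingLinf (n : ℕ) : NormedCommRing (Linf n) where
  __ := (inferInstance : NormedAddCommGroup (Linf n))
  mul_assoc f g h := Subtype.ext (mul_assoc f.1 g.1 h.1)
  mul_comm f g := Subtype.ext (mul_comm f.1 g.1)
  one_mul f := Subtype.ext (one_mul f.1)
  mul_one f := Subtype.ext (mul_one f.1)
  left_distrib f g h := by
    apply Lp.ext
    filter_upwards [Linf.coeFn_mul f (g + h), Linf.coeFn_mul f g, Linf.coeFn_mul f h,
      Lp.coeFn_add g h, Lp.coeFn_add (f * g) (f * h)] with ξ h1 h2 h3 h4 h5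
    rw [h1, h5, Pi.add_apply, h2, h3, h4, Pi.add_apply, mul_add]
  right_distrib f g h := by
    apply Lp.ext
    filter_upwards [Linf.coeFn_mul (f + g) h, Linf.coeFn_mul f h, Linf.coeFn_mul g h,
      Lp.coeFn_add f g, Lp.coeFn_add (f * h) (g * h)] with ξ h1 h2 h3 h4 h5
    rw [h1, h5, Pi.add_apply, h2, h3, h4, Pi.add_apply, add_mul]
  zero_mul f := by
    apply Lp.ext
    filter_upwards [Linf.coeFn_mul 0 f, Lp.coeFn_zero ℂ ∞ (volume : Measure (Rn n))] with ξ h1 h2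
    rw [h1, h2, Pi.zero_apply, zero_mul]
  mul_zero f := by
    apply Lp.ext
    filter_upwards [Linf.coeFn_mul f 0, Lp.coeFn_zero ℂ ∞ (volume : Measure (Rn n))] with ξ h1 h2
    rw [h1, h2, Pi.zero_apply, mul_zero]
  norm_mul_le f g := by
    refine Linf.norm_le _ (by positivity) ?_
    filter_upwards [Linf.coeFn_mul f g, Linf.ae_norm_le f, Linf.ae_norm_le g] with ξ h1 h2 h3
    rw [h1, norm_mul]
    gcongr

instance instAlgebraLinf (n : ℕ) : Algebra ℂ (Linf n) :=
  Algebra.ofModule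
    (by
      intro c f g
      apply Lp.ext
      filter_upwards [Linf.coeFn_mul (c • f) g, Linf.coeFn_mul f g, Lp.coeFn_smul c f,
        Lp.coeFn_smul c (f * g)] with ξ h1 h2 h3 h4
      rw [h1, h4, h3, Pi.smul_apply, Pi.smul_apply, h2, smul_eq_mul, smul_eq_mul, mul_assoc])
    (by
      intro c f g
      apply Lp.ext
      filter_upwards [Linf.coeFn_mul f (c • g), Linf.coeFn_mul f g, Lp.coeFn_smul c g,
        Lp.coeFn_smul c (f * g)] with ξ h1 h2 h3 h4
      rw [h1, h4, h3, Pi.smul_apply, Pi.smul_apply, h2, smul_eq_mul, smul_eq_mul]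
      ring)

instance instNormedAlgebraLinf (n : ℕ) : NormedAlgebra ℂ (Linf n) where
  __ := instAlgebraLinf n
  norm_smul_le c f := norm_smul_le c f

/-- The operator of multiplication by `f ∈ L^∞(ℝⁿ)` on `L²(ℝⁿ)`. -/
def mulOp {n : ℕ} (f : Linf n) : L2 n →L[ℂ] L2 n :=
  (ContinuousLinearMap.mul ℂ ℂ).holderL volume ∞ 2 2 f

lemma coeFn_mulOp {n : ℕ} (f : Linf n) (u : L2 n) :
    (mulOp f u : Rn n → ℂ) =ᵐ[volume] fun x => f x * u x :=
  ContinuousLinearMap.coeFn_holder (r := 2) (ContinuousLinearMap.mul ℂ ℂ) f u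

lemma mulOp_add {n : ℕ} (f g : Linf n) : mulOp (f + g) = mulOp f + mulOp g := by
  simp only [mulOp, map_add]

lemma mulOp_mul {n : ℕ} (f g : Linf n) : mulOp (f * g) = (mulOp f).comp (mulOp g) := by
  ext1 u
  apply Lp.ext
  filter_upwards [coeFn_mulOp (f * g) u, coeFn_mulOp f (mulOp g u), coeFn_mulOp g u,
    Linf.coeFn_mul f g] with x h1 h2 h3 h4
  rw [h1, h4, ContinuousLinearMap.comp_apply, h2, h3, mul_assoc]

lemma mulOp_algebraMap {n : ℕ} (c : ℂ) :
    mulOp (algebraMap ℂ (Linf n) c) = c • ContinuousLinearMap.id ℂ (L2 n) := by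
  have h1 : mulOp (1 : Linf n) = ContinuousLinearMap.id ℂ (L2 n) := by
    ext1 u
    apply Lp.ext
    filter_upwards [coeFn_mulOp (1 : Linf n) u, Linf.coeFn_one (n := n)] with x h2 h3
    rw [h2, h3, one_mul, ContinuousLinearMap.id_apply]
  rw [← h1, Algebra.algebraMap_eq_smul_one]
  simp only [mulOp, map_smul]

/-- The Fourier transform `F u (ξ) = ∫ e^{-2πi ξ·x} u(x) dx` as a unitary operator on
`L²(ℝⁿ)`. -/
def fourierOp (n : ℕ) : L2 n ≃ₗᵢ[ℂ] L2 n := Lp.fourierTransformₗᵢ (Rn n) ℂ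

/-- The pseudodifferential operator `A_ψ` with symbol `ψ ∈ L^∞(ℝⁿ)`:
`F (A_ψ u) (ξ) = ψ(ξ) F(u)(ξ)`. -/
def opA {n : ℕ} (ψ : Linf n) : L2 n →L[ℂ] L2 n :=
  ((fourierOp n).symm.toContinuousLinearEquiv : L2 n →L[ℂ] L2 n).comp
    ((mulOp ψ).comp ((fourierOp n).toContinuousLinearEquiv : L2 n →L[ℂ] L2 n))

lemma opA_add {n : ℕ} (f g : Linf n) : opA (f + g) = opA f + opA g := by
  ext1 u
  simp [opA, mulOp_add]

lemma opA_mul {n : ℕ} (f g : Linf n) : opA (f * g) = (opA f).comp (opA g) := by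
  ext1 u
  simp [opA, mulOp_mul]

lemma opA_algebraMap {n : ℕ} (c : ℂ) :
    opA (algebraMap ℂ (Linf n) c) = c • ContinuousLinearMap.id ℂ (L2 n) := by
  ext1 u
  simp [opA, mulOp_algebraMap]

/-- A compactly supported continuous function as an element of `L^∞(ℝⁿ)`. -/
def ofCc {n : ℕ} (Φ : CompactlySupportedContinuousMap (Rn n) ℂ) : Linf n :=
  (Φ.continuous.memLp_top_of_hasCompactSupport Φ.hasCompactSupport volume).toLp Φ

/-- The operator `B_Φ` of multiplication by `Φ ∈ C_0(ℝⁿ)` on `L²(ℝⁿ)`. -/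
def opB {n : ℕ} (Φ : CompactlySupportedContinuousMap (Rn n) ℂ) : L2 n →L[ℂ] L2 n :=
  mulOp (ofCc Φ)

/-- The commutator `[A_ψ, B_Φ] = A_ψ B_Φ - B_Φ A_ψ`. -/
def symbolCommutator {n : ℕ} (ψ : Linf n) (Φ : CompactlySupportedContinuousMap (Rn n) ℂ) :
    L2 n →L[ℂ] L2 n :=
  (opA ψ).comp (opB Φ) - (opB Φ).comp (opA ψ)

/-- The algebra `A` of admissible symbols: all `ψ ∈ L^∞(ℝⁿ)` such that `[A_ψ, B_Φ]` is a compact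
operator on `L²(ℝⁿ)` for every `Φ ∈ C_0(ℝⁿ)`. -/
def symbolAlg (n : ℕ) : Subalgebra ℂ (Linf n) where
  carrier := {ψ | ∀ Φ : CompactlySupportedContinuousMap (Rn n) ℂ,
    IsCompactOperator (symbolCommutator ψ Φ)}
  mul_mem' := by
    intro f g hf hg Φ
    have h : symbolCommutator (f * g) Φ
        = (opA f).comp (symbolCommutator g Φ) + (symbolCommutator f Φ).comp (opA g) := by
      ext1 u
      simp [symbolCommutator, opA_mul]
    rw [h]
    exact ((hg Φ).clm_comp (opA f)).add ((hf Φ).comp_clm (opA g))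
  add_mem' := by
    intro f g hf hg Φ
    have h : symbolCommutator (f + g) Φ = symbolCommutator f Φ + symbolCommutator g Φ := by
      ext1 u
      simp only [symbolCommutator, opA_add, ContinuousLinearMap.add_comp, ContinuousLinearMap.comp_add]
      congr 1
      abel
    rw [h]
    exact (hf Φ).add (hg Φ)
  algebraMap_mem' := by
    intro c Φ
    have h : symbolCommutator (algebraMap ℂ (Linf n) c) Φ = 0 := by
      ext1 u
      simp [symbolCommutator, opA_algebraMap]
    rw [h]
    exact isCompactOperator_zero

/-- `ess lim ψ(ξ) = 0` as `|ξ| → ∞`. -/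
def VanishesAtInfinity {n : ℕ} (ψ : Linf n) : Prop :=
  ∀ ε : ℝ, 0 < ε → ∃ R : ℝ, ∀ᵐ ξ : Rn n, R < ‖ξ‖ → ‖ψ ξ‖ ≤ ε

/-- The ideal `A_0` of `A`, consisting of the symbols vanishing at infinity. -/
def vanishingIdeal (n : ℕ) : Ideal (symbolAlg n) where
  carrier := {a | VanishesAtInfinity (a : Linf n)}
  zero_mem' := by
    intro ε hε
    refine ⟨0, ?_⟩
    filter_upwards [Lp.coeFn_zero ℂ ∞ (volume : Measure (Rn n))] with ξ h _
    change ‖(0 : Linf n) ξ‖ ≤ ε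
    rw [h]
    simpa using hε.le
  add_mem' := by
    intro a b ha hb ε hε
    obtain ⟨R, hR⟩ := ha (ε / 2) (half_pos hε)
    obtain ⟨T, hT⟩ := hb (ε / 2) (half_pos hε)
    refine ⟨max R T, ?_⟩
    filter_upwards [hR, hT, Lp.coeFn_add (a : Linf n) (b : Linf n)] with ξ h1 h2 h3 h4
    change ‖((a : Linf n) + (b : Linf n) : Linf n) ξ‖ ≤ ε
    rw [h3]
    have h5 := h1 (lt_of_le_of_lt (le_max_left _ _) h4)
    have h6 := h2 (lt_of_le_of_lt (le_max_right _ _) h4)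
    exact (norm_add_le _ _).trans (by linarith)
  smul_mem' := by
    intro c a ha ε hε
    have hC : 0 < ‖(c : Linf n)‖ + 1 := by positivity
    obtain ⟨R, hR⟩ := ha (ε / (‖(c : Linf n)‖ + 1)) (div_pos hε hC)
    refine ⟨R, ?_⟩
    filter_upwards [hR, Linf.ae_norm_le (c : Linf n),
      Linf.coeFn_mul (c : Linf n) (a : Linf n)] with ξ h1 h2 h3 h4
    change ‖((c : Linf n) * (a : Linf n) : Linf n) ξ‖ ≤ ε
    rw [h3, norm_mul]
    calc _ ≤ (‖(c : Linf n)‖ + 1) * (ε / (‖(c : Linf n)‖ + 1)) := by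
          gcongr
          · linarith
          · exact h1 h4
      _ = ε := by field_simp

/-- The quotient algebra `𝒜 = A / A_0`, with the quotient (semi)norm. -/
abbrev QuotAlg (n : ℕ) : Type := symbolAlg n ⧸ vanishingIdeal n

/-- The spectrum `𝔖` of the commutative unital Banach algebra `𝒜 = A / A_0`: the space of its
characters (nonzero continuous multiplicative linear functionals). For a class `a`, the value at
`η` of its Gelfand transform is `â(η) = η a`. -/
abbrev SymbolSpectrum (n : ℕ) : Type := WeakDual.characterSpace ℂ (QuotAlg n)

/-- `|ξ̃|² + |ξ̄|⁴`, where `ξ̃`, `ξ̄` are the orthogonal projections of `ξ` on `X`, `X^⊥`. -/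
def anisoWeight {n : ℕ} (X : Submodule ℝ (Rn n)) (ξ : Rn n) : ℝ :=
  ‖X.starProjection ξ‖ ^ 2 + ‖Xᗮ.starProjection ξ‖ ^ 4

/-- The manifold `S_X = {ξ ∈ ℝⁿ : |ξ̃|² + |ξ̄|⁴ = 1}`. -/
def anisoSphere {n : ℕ} (X : Submodule ℝ (Rn n)) : Set (Rn n) :=
  {ξ | anisoWeight X ξ = 1}

/-- The map `π_X(ξ) = ξ̃ / (|ξ̃|² + |ξ̄|⁴)^{1/2} + ξ̄ / (|ξ̃|² + |ξ̄|⁴)^{1/4}`. -/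
def anisoProj {n : ℕ} (X : Submodule ℝ (Rn n)) (ξ : Rn n) : Rn n :=
  (anisoWeight X ξ ^ (1 / 2 : ℝ))⁻¹ • X.starProjection ξ
    + (anisoWeight X ξ ^ (1 / 4 : ℝ))⁻¹ • Xᗮ.starProjection ξ

lemma anisoWeight_pos {n : ℕ} (X : Submodule ℝ (Rn n)) {ξ : Rn n} (hξ : ξ ≠ 0) :
    0 < anisoWeight X ξ := by
  by_contra h
  have h1 : 0 ≤ ‖X.starProjection ξ‖ ^ 2 := by positivity
  have h2 : 0 ≤ ‖Xᗮ.starProjection ξ‖ ^ 4 := by positivity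
  unfold anisoWeight at h
  have h3 : ‖X.starProjection ξ‖ ^ 2 = 0 := by linarith
  have h4 : ‖Xᗮ.starProjection ξ‖ ^ 4 = 0 := by linarith
  apply hξ
  rw [← X.starProjection_add_starProjection_orthogonal ξ]
  have h5 : X.starProjection ξ = 0 := by simpa using h3
  have h6 : Xᗮ.starProjection ξ = 0 := by simpa using h4
  rw [h5, h6, add_zero]

lemma anisoProj_mem {n : ℕ} (X : Submodule ℝ (Rn n)) {ξ : Rn n} (hξ : ξ ≠ 0) :
    anisoProj X ξ ∈ anisoSphere X := by
  have hw := anisoWeight_pos X hξ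
  have hX : X.starProjection ξ ∈ X := X.starProjection_apply_mem ξ
  have hY : Xᗮ.starProjection ξ ∈ Xᗮ := Xᗮ.starProjection_apply_mem ξ
  have e1 : X.starProjection (anisoProj X ξ)
      = (anisoWeight X ξ ^ (1 / 2 : ℝ))⁻¹ • X.starProjection ξ := by
    rw [anisoProj, map_add, map_smul, map_smul,
      Submodule.starProjection_eq_self_iff.2 hX,
      (Submodule.starProjection_apply_eq_zero_iff X).2 hY, smul_zero, add_zero]
  have e2 : Xᗮ.starProjection (anisoProj X ξ)
      = (anisoWeight X ξ ^ (1 / 4 : ℝ))⁻¹ • Xᗮ.starProjection ξ := by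
    rw [anisoProj, map_add, map_smul, map_smul,
      Submodule.starProjection_eq_self_iff.2 hY,
      (Submodule.starProjection_apply_eq_zero_iff Xᗮ).2 (X.le_orthogonal_orthogonal hX),
      smul_zero, zero_add]
  change anisoWeight X (anisoProj X ξ) = 1
  rw [anisoWeight, e1, e2, norm_smul, norm_smul, mul_pow, mul_pow, norm_inv, norm_inv, inv_pow,
    inv_pow, Real.norm_of_nonneg (by positivity), Real.norm_of_nonneg (by positivity),
    ← Real.rpow_natCast, ← Real.rpow_natCast (_ ^ (1 / 4 : ℝ)), ← Real.rpow_mul hw.le,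
    ← Real.rpow_mul hw.le]
  rw [show (1 / 2 : ℝ) * (2 : ℕ) = 1 by norm_num, show (1 / 4 : ℝ) * (4 : ℕ) = 1 by norm_num,
    Real.rpow_one, ← mul_add]
  exact inv_mul_cancel₀ hw.ne'

/-- The projection `π_X : ℝⁿ ∖ {0} → S_X`. -/
def anisoProjTo {n : ℕ} (X : Submodule ℝ (Rn n)) (ξ : {ξ : Rn n // ξ ≠ 0}) : anisoSphere X :=
  ⟨anisoProj X ξ, anisoProj_mem X ξ.2⟩

lemma continuous_anisoProjTo {n : ℕ} (X : Submodule ℝ (Rn n)) :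
    Continuous (anisoProjTo X) := by
  have hw : Continuous fun ξ : {ξ : Rn n // ξ ≠ 0} => anisoWeight X ξ := by
    unfold anisoWeight
    fun_prop
  have hp : ∀ r : ℝ, Continuous fun ξ : {ξ : Rn n // ξ ≠ 0} => (anisoWeight X ξ ^ r)⁻¹ := fun r =>
    (hw.rpow_const fun ξ => Or.inl (anisoWeight_pos X ξ.2).ne').inv₀ fun ξ =>
      (Real.rpow_pos_of_pos (anisoWeight_pos X ξ.2) r).ne'
  refine Continuous.subtype_mk ?_ _
  unfold anisoProj
  exact ((hp _).smul (by fun_prop)).add ((hp _).smul (by fun_prop))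

open Classical in
/-- The function `ξ ↦ ψ(π_X(ξ))` on `ℝⁿ ∖ {0}`, extended by `0` at the origin. -/
def quasiHomFun {n : ℕ} (X : Submodule ℝ (Rn n)) (ψ : C(anisoSphere X, ℂ)) (ξ : Rn n) : ℂ :=
  if h : ξ ≠ 0 then ψ (anisoProjTo X ⟨ξ, h⟩) else 0

instance instCompactSpaceAnisoSphere {n : ℕ} (X : Submodule ℝ (Rn n)) :
    CompactSpace (anisoSphere X) := by
  refine isCompact_iff_compactSpace.1 (Metric.isCompact_of_isClosed_isBounded ?_ ?_)
  · refine isClosed_eq ?_ continuous_const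
    unfold anisoWeight
    fun_prop
  · refine (Metric.isBounded_iff_subset_closedBall 0).2 ⟨2, fun ξ hξ => ?_⟩
    have h : ‖X.starProjection ξ‖ ^ 2 + ‖Xᗮ.starProjection ξ‖ ^ 4 = 1 := hξ
    have h1 : ‖X.starProjection ξ‖ ≤ 1 := by
      by_contra! hc
      nlinarith [pow_nonneg (norm_nonneg (Xᗮ.starProjection ξ)) 4]
    have h2 : ‖Xᗮ.starProjection ξ‖ ≤ 1 := by
      by_contra! hc
      nlinarith [one_lt_pow₀ hc (n := 4) (by norm_num), sq_nonneg ‖X.starProjection ξ‖]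
    rw [mem_closedBall_zero_iff]
    calc ‖ξ‖ = ‖X.starProjection ξ + Xᗮ.starProjection ξ‖ := by
          rw [X.starProjection_add_starProjection_orthogonal ξ]
      _ ≤ ‖X.starProjection ξ‖ + ‖Xᗮ.starProjection ξ‖ := norm_add_le _ _
      _ ≤ 2 := by linarith

lemma quasiHomFun_memLp {n : ℕ} (X : Submodule ℝ (Rn n)) (ψ : C(anisoSphere X, ℂ)) :
    MemLp (quasiHomFun X ψ) ∞ (volume : Measure (Rn n)) := by
  refine memLp_top_of_bound ?_ ‖ψ‖ (Filter.Eventually.of_forall fun ξ => ?_)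
  · have hc : Continuous fun ξ : {ξ : Rn n // ξ ≠ 0} => ψ (anisoProjTo X ξ) :=
      ψ.continuous.comp (continuous_anisoProjTo X)
    exact (Measurable.dite (s := {ξ : Rn n | ξ ≠ 0}) hc.measurable measurable_const
      (measurableSet_singleton (0 : Rn n)).compl).aestronglyMeasurable
  · unfold quasiHomFun
    split_ifs
    · exact ψ.norm_coe_le_norm _
    · simp

/-- The bounded quasi-homogeneous symbol `ψ(π_X(ξ))`, as an element of `L^∞(ℝⁿ)`. -/
def quasiHom {n : ℕ} (X : Submodule ℝ (Rn n)) (ψ : C(anisoSphere X, ℂ)) : Linf n :=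
  (quasiHomFun_memLp X ψ).toLp (quasiHomFun X ψ)

/-- `s = p_X(η)`: the point `s` of `S_X` is the image of `η ∈ 𝔖` under the projection of spectra
`p_X : 𝔖 → S_X` dual to the embedding `A_X ⊂ 𝒜` of the algebra `A_X = {ψ ∘ π_X : ψ ∈ C(S_X)}`.
That is, every `ψ ∘ π_X` lies in `A`, and the Gelfand transform of its class takes the value
`ψ(s)` at `η`. -/
def IsSpectralProjection {n : ℕ} (η : SymbolSpectrum n) (X : Submodule ℝ (Rn n))
    (s : anisoSphere X) : Prop :=
  ∀ ψ : C(anisoSphere X, ℂ), ∃ h : quasiHom X ψ ∈ symbolAlg n,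
    η (Ideal.Quotient.mk (vanishingIdeal n) ⟨quasiHom X ψ, h⟩) = ψ s

/-- `u ⇈ v`: the (nonzero) vectors `u` and `v` are co-directed. -/
def CoDirected {n : ℕ} (u v : Rn n) : Prop :=
  u ≠ 0 ∧ v ≠ 0 ∧ ∃ c : ℝ, 0 < c ∧ u = c • v

/-- The properties required of the system `ζ_1, …, ζ_m` (here `ζ 0, …, ζ (m - 1)`) and of the
integer `d`, for the family of points `p X ∈ S_X`. -/
structure IsAdapted {n : ℕ} (p : (X : Submodule ℝ (Rn n)) → anisoSphere X)
    {m : ℕ} (ζ : Fin m → Rn n) (d : ℕ) : Prop where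
  /-- The system is orthonormal. -/
  orthonormal : Orthonormal ℝ ζ
  /-- `d ∈ {m - 1, m}`. -/
  d_eq : d = m ∨ d + 1 = m
  /-- `ξ̃_X ≠ 0` if and only if `X` contains the span of `ζ_1, …, ζ_d`. -/
  tilde_iff : ∀ X : Submodule ℝ (Rn n), X.starProjection (p X : Rn n) ≠ 0 ↔
    Submodule.span ℝ (ζ '' {k : Fin m | (k : ℕ) < d}) ≤ X
  /-- If `ξ̃_X ≠ 0`, then `ξ̃_X ⇈ ζ_1`. -/
  tilde_dir : ∀ X : Submodule ℝ (Rn n), X.starProjection (p X : Rn n) ≠ 0 →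
    ∃ h : 0 < m, CoDirected (X.starProjection (p X : Rn n)) (ζ ⟨0, h⟩)
  /-- `ξ̄_X ≠ 0` if and only if `X` does not contain the span of `ζ_1, …, ζ_m`. -/
  bar_iff : ∀ X : Submodule ℝ (Rn n), Xᗮ.starProjection (p X : Rn n) ≠ 0 ↔
    ¬ Submodule.span ℝ (Set.range ζ) ≤ X
  /-- If `ξ̄_X ≠ 0`, then `ξ̄_X ⇈ pr_{X^⊥} ζ_k` for `k = k(X) = min {k | ζ_k ∉ X}`. -/
  bar_dir : ∀ X : Submodule ℝ (Rn n), Xᗮ.starProjection (p X : Rn n) ≠ 0 →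
    ∃ k : Fin m, IsLeast {k : Fin m | ζ k ∉ X} k ∧
      CoDirected (Xᗮ.starProjection (p X : Rn n)) (Xᗮ.starProjection (ζ k))

end HSymbol

end

/-! All the maps π_X are followed to infinity simultaneously. The joint map ξ ↦ (π_X(ξ))_X into the
compact product of the S_X is slowly oscillating: π_X is invariant under the dilations ξ ↦ s²ξ̃ +
sξ̄, and the dilation that brings ξ to S_X shrinks bounded shifts to zero as |ξ| → ∞
(`eventually_dist_anisoProj_lt`). Bounded slowly oscillating symbols are admissible
(`mem_symbolAlg_of_slowlyOscillating`): on the frequency side, and up to uniform approximation of Φ,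
the commutator has kernel k(ξ - t)(ψ(ξ) - ψ(t)) with k Schwartz. Truncated to a ball in ξ it is
compact by a Hilbert–Schmidt argument, and the remainder is small in norm by Young's inequality.
Hence η acts on continuous functions of the joint map as evaluation at one point (p_X)_X. Symbols
vanishing near infinity die in 𝒜, so this is a cluster point at infinity, and a single ultrafilter U
→ ∞ has π_X(ξ) → p_X for every X (`exists_ultrafilter_of_spectrum`).

The rest is geometry along U. Put ξ_0 = ξ, let ζ_{k+1} = lim ξ_k/|ξ_k|, and let ξ_{k+1} be ξ_k
without its ζ_{k+1} component, so that |ξ_{k+1}| = o(|ξ_k|). If ζ_{k+1} is the first direction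
outside X, then |ξ̄| is comparable to |ξ_k| and ξ̄ is asymptotically directed along pr ζ_{k+1}; if
also k > 0, then |ξ̃| ~ |ξ| with direction ζ_1. The ratio |ξ̄|⁴/|ξ̃|², which decides which part of
p_X survives, thus behaves like the square of g_k = |ξ_k|²/|ξ|. Take for m the first index with g_m
→ 0, and for d the number of k < m with g_k → ∞. If g_{k+1} does not tend to 0 then g_k → ∞, so only
k = m - 1 can be intermediate, which is why d is m - 1 or m.

Uniqueness follows by testing on X spanned by initial segments of the system. -/

noncomputable section

namespace HSymbol

/-! ### Compactness of Hilbert–Schmidt type operators -/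

section HilbertSchmidt

variable {α E : Type*} [MeasurableSpace α] (μ : Measure α) [NormedAddCommGroup E] [NormedSpace ℂ E]

/-- The Hilbert–Schmidt type operator `u ↦ (ξ ↦ f ξ u)` attached to a square integrable family of
functionals. -/
def hsOp : Lp (E →L[ℂ] ℂ) 2 μ →L[ℂ] E →L[ℂ] Lp ℂ 2 μ :=
  LinearMap.mkContinuous₂
    (LinearMap.mk₂ ℂ (fun (f : Lp (E →L[ℂ] ℂ) 2 μ) (u : E) =>
        (ContinuousLinearMap.apply ℂ ℂ u).compLp f)
      (fun f g u => ((ContinuousLinearMap.apply ℂ ℂ u).compLpₗ 2 μ).map_add f g)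
      (fun c f u => ((ContinuousLinearMap.apply ℂ ℂ u).compLpₗ 2 μ).map_smul c f)
      (fun f u v => by
        simp only [map_add]
        exact ContinuousLinearMap.add_compLp _ _ _)
      (fun c f u => by
        simp only [map_smul]
        exact ContinuousLinearMap.smul_compLp _ _ _))
    1 (fun f u => by
      refine (ContinuousLinearMap.norm_compLp_le _ _).trans ?_
      rw [one_mul, mul_comm]
      gcongr
      refine ContinuousLinearMap.opNorm_le_bound _ (norm_nonneg _) fun T => ?_
      simpa [mul_comm] using T.le_opNorm u)

lemma coeFn_hsOp (f : Lp (E →L[ℂ] ℂ) 2 μ) (u : E) :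
    (hsOp μ f u : α → ℂ) =ᵐ[μ] fun ξ => f ξ u :=
  ContinuousLinearMap.coeFn_compLp _ f

/-- Indicator families give operators of rank at most one; simple families are dense and compactness
is preserved by norm limits. -/
lemma isCompactOperator_hsOp (f : Lp (E →L[ℂ] ℂ) 2 μ) : IsCompactOperator (hsOp μ f) := by
  refine Lp.induction (p := 2) (by norm_num) (motive := fun f => IsCompactOperator (hsOp μ f))
    ?_ ?_ ?_ f
  · intro c s hs hμs
    have h : hsOp μ (Lp.simpleFunc.indicatorConst 2 hs hμs.ne c : Lp (E →L[ℂ] ℂ) 2 μ)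
        = (ContinuousLinearMap.toSpanSingleton ℂ
            (indicatorConstLp 2 hs hμs.ne (1 : ℂ))).comp c := by
      ext1 u
      apply Lp.ext
      rw [Lp.simpleFunc.coe_indicatorConst]
      filter_upwards [coeFn_hsOp μ (indicatorConstLp 2 hs hμs.ne c) u,
        indicatorConstLp_coeFn (p := 2) (hs := hs) (hμs := hμs.ne) (c := c),
        Lp.coeFn_smul (c u) (indicatorConstLp 2 hs hμs.ne (1 : ℂ)),
        indicatorConstLp_coeFn (p := 2) (hs := hs) (hμs := hμs.ne) (c := (1 : ℂ))]
        with ξ h1 h2 h3 h4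
      rw [h1, h2, ContinuousLinearMap.comp_apply, ContinuousLinearMap.toSpanSingleton_apply, h3,
        Pi.smul_apply, h4]
      by_cases hξ : ξ ∈ s <;> simp [hξ]
    rw [h]
    exact (isCompactOperator_of_locallyCompactSpace_rng (ContinuousLinearMap.toSpanSingleton ℂ
      (indicatorConstLp 2 hs hμs.ne (1 : ℂ)))).comp_clm c
  · intro f g hf hg _ h1 h2
    rw [map_add]
    exact h1.add h2
  · exact isClosed_setOfPred_isCompactOperator.preimage (hsOp μ).continuous

end HilbertSchmidt

/-! ### Young's inequality L¹ * L² → L² -/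

section Young

variable {G : Type*} [NormedAddCommGroup G] [MeasurableSpace G] [BorelSpace G]
  [SecondCountableTopology G] (μ : Measure G) [SFinite μ] [μ.IsAddLeftInvariant]
  [μ.IsNegInvariant]

/-- Cauchy–Schwarz for the factors k^{1/2} and k^{1/2} f. -/
lemma sq_lintegral_mul_le {α : Type*} [MeasurableSpace α] (μ : Measure α) {k f : α → ℝ≥0∞}
    (hk : AEMeasurable k μ) (hf : AEMeasurable f μ) :
    (∫⁻ t, k t * f t ∂μ) ^ 2 ≤ (∫⁻ t, k t ∂μ) * ∫⁻ t, k t * f t ^ 2 ∂μ := by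
  have h := ENNReal.lintegral_mul_le_Lp_mul_Lq μ Real.HolderConjugate.two_two
    (f := fun t => k t ^ (1 / 2 : ℝ)) (g := fun t => k t ^ (1 / 2 : ℝ) * f t)
    (hk.pow_const _) ((hk.pow_const _).mul hf)
  have e0 : ∀ a : ℝ≥0∞, a ^ (1 / 2 : ℝ) * a ^ (1 / 2 : ℝ) = a := fun a => by
    rw [← ENNReal.rpow_add_of_nonneg _ _ (by norm_num) (by norm_num)]; norm_num
  have e2 : ∀ a : ℝ≥0∞, (a ^ (1 / 2 : ℝ)) ^ (2 : ℝ) = a := fun a => by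
    rw [← ENNReal.rpow_mul]; norm_num
  have e1 : ∀ t, ((fun t => k t ^ (1 / 2 : ℝ)) * fun t => k t ^ (1 / 2 : ℝ) * f t) t
      = k t * f t := fun t => by
    simp only [Pi.mul_apply]
    rw [← mul_assoc, e0]
  simp only [e1, ENNReal.mul_rpow_of_nonneg _ _ (zero_le_two), e2] at h
  calc _ ≤ ((∫⁻ t, k t ∂μ) ^ (1 / 2 : ℝ) * (∫⁻ t, k t * f t ^ (2 : ℝ) ∂μ) ^ (1 / 2 : ℝ)) ^ 2 := by
        gcongr
    _ = _ := by
        rw [mul_pow, ← ENNReal.rpow_natCast, ← ENNReal.rpow_natCast (_ ^ (1 / 2 : ℝ))]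
        norm_num [e2, ← ENNReal.rpow_mul]

lemma lintegral_sq_conv_le {k f : G → ℝ≥0∞} (hk : Measurable k) (hf : AEMeasurable f μ) :
    ∫⁻ ξ, (∫⁻ t, k (ξ - t) * f t ∂μ) ^ 2 ∂μ ≤ (∫⁻ t, k t ∂μ) ^ 2 * ∫⁻ t, f t ^ 2 ∂μ := by
  have hk' : ∀ ξ, ∫⁻ t, k (ξ - t) ∂μ = ∫⁻ t, k t ∂μ := fun ξ => lintegral_sub_left_eq_self k ξ
  have hk'' : ∀ t, ∫⁻ ξ, k (ξ - t) ∂μ = ∫⁻ t, k t ∂μ := fun t => lintegral_sub_right_eq_self k t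
  calc _ ≤ ∫⁻ ξ, (∫⁻ t, k t ∂μ) * ∫⁻ t, k (ξ - t) * f t ^ 2 ∂μ ∂μ := by
        refine lintegral_mono fun ξ => ?_
        rw [← hk' ξ]
        exact sq_lintegral_mul_le μ (by fun_prop) hf
    _ = (∫⁻ t, k t ∂μ) * ∫⁻ ξ, ∫⁻ t, k (ξ - t) * f t ^ 2 ∂μ ∂μ := by
        refine lintegral_const_mul'' _ ?_
        refine AEMeasurable.lintegral_prod_right' (f := fun p : G × G => k (p.1 - p.2) * f p.2 ^ 2) ?_
        exact ((hk.comp (measurable_fst.sub measurable_snd)).aemeasurable).mul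
          (hf.comp_snd.pow_const 2)
    _ = (∫⁻ t, k t ∂μ) * ∫⁻ t, ∫⁻ ξ, k (ξ - t) * f t ^ 2 ∂μ ∂μ := by
        rw [lintegral_lintegral_swap]
        exact ((hk.comp (measurable_fst.sub measurable_snd)).aemeasurable).mul
          (hf.comp_snd.pow_const 2)
    _ = _ := by
        have : ∀ t, ∫⁻ ξ, k (ξ - t) * f t ^ 2 ∂μ = (∫⁻ t, k t ∂μ) * f t ^ 2 := fun t => by
          rw [lintegral_mul_const _ (by fun_prop), hk'']
        simp only [this]
        rw [lintegral_const_mul'' _ (hf.pow_const 2), sq, mul_assoc]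

lemma eLpNorm_two_le_of_enorm_le_conv {F : Type*} [NormedAddCommGroup F] {k : G → ℝ≥0∞}
    {f v : G → F} (hk : Measurable k) (hv : AEStronglyMeasurable v μ)
    (h : ∀ᵐ ξ ∂μ, ‖f ξ‖ₑ ≤ ∫⁻ t, k (ξ - t) * ‖v t‖ₑ ∂μ) :
    eLpNorm f 2 μ ≤ (∫⁻ t, k t ∂μ) * eLpNorm v 2 μ := by
  rw [eLpNorm_eq_lintegral_rpow_enorm_toReal (by norm_num) (by norm_num),
    eLpNorm_eq_lintegral_rpow_enorm_toReal (by norm_num) (by norm_num)]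
  simp only [ENNReal.toReal_ofNat, ENNReal.rpow_ofNat]
  calc (∫⁻ ξ, ‖f ξ‖ₑ ^ 2 ∂μ) ^ (1 / 2 : ℝ)
      ≤ ((∫⁻ t, k t ∂μ) ^ 2 * ∫⁻ t, ‖v t‖ₑ ^ 2 ∂μ) ^ (1 / 2 : ℝ) := by
        gcongr
        refine le_trans (lintegral_mono_ae ?_) (lintegral_sq_conv_le μ hk hv.enorm)
        filter_upwards [h] with ξ hξ
        gcongr
    _ = _ := by
        rw [ENNReal.mul_rpow_of_nonneg _ _ (by norm_num), ← ENNReal.rpow_natCast,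
          ← ENNReal.rpow_mul]
        norm_num

end Young

/-! ### Multiplication operators as convolutions on the frequency side -/

section Convolution

open FourierTransform SchwartzMap

variable {n : ℕ}

/-- Multiplication by the inverse Fourier transform of a Schwartz function `k`, seen on the
frequency side. -/
def freqMul (k : 𝓢(Rn n, ℂ)) : L2 n →L[ℂ] L2 n :=
  ((fourierOp n).toContinuousLinearEquiv : L2 n →L[ℂ] L2 n).comp
    ((mulOp ((𝓕⁻ k : 𝓢(Rn n, ℂ)).toLp ∞ volume)).comp
      ((fourierOp n).symm.toContinuousLinearEquiv : L2 n →L[ℂ] L2 n))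

lemma fourierInv_convolution_apply (k v : 𝓢(Rn n, ℂ)) (x : Rn n) :
    (𝓕⁻ (convolution (ContinuousLinearMap.mul ℂ ℂ) k v)) x = (𝓕⁻ k) x * (𝓕⁻ v) x := by
  simp only [fourierInv_apply_eq, fourier_convolution]
  simp

lemma fourierOp_toLp (v : 𝓢(Rn n, ℂ)) : fourierOp n (v.toLp 2) = (𝓕 v).toLp 2 :=
  toLp_fourier_eq v

lemma fourierOp_symm_toLp (v : 𝓢(Rn n, ℂ)) : (fourierOp n).symm (v.toLp 2) = (𝓕⁻ v).toLp 2 :=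
  toLp_fourierInv_eq v

lemma freqMul_toLp (k v : 𝓢(Rn n, ℂ)) :
    freqMul k (v.toLp 2) = (convolution (ContinuousLinearMap.mul ℂ ℂ) k v).toLp 2 := by
  have h : mulOp ((𝓕⁻ k : 𝓢(Rn n, ℂ)).toLp ∞ volume) ((𝓕⁻ v : 𝓢(Rn n, ℂ)).toLp 2 volume)
      = (𝓕⁻ (convolution (ContinuousLinearMap.mul ℂ ℂ) k v) : 𝓢(Rn n, ℂ)).toLp 2 volume := by
    apply Lp.ext
    filter_upwards [coeFn_mulOp ((𝓕⁻ k : 𝓢(Rn n, ℂ)).toLp ∞ volume) ((𝓕⁻ v : 𝓢(Rn n, ℂ)).toLp 2 volume),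
      (𝓕⁻ k).coeFn_toLp ∞ volume, (𝓕⁻ v).coeFn_toLp 2 volume,
      (𝓕⁻ (convolution (ContinuousLinearMap.mul ℂ ℂ) k v)).coeFn_toLp 2 volume] with x h1 h2 h3 h4
    rw [h1, h2, h3, h4, fourierInv_convolution_apply]
  change fourierOp n (mulOp ((𝓕⁻ k : 𝓢(Rn n, ℂ)).toLp ∞ volume)
    ((fourierOp n).symm (v.toLp 2 volume))) = _
  rw [fourierOp_symm_toLp, h, fourierOp_toLp, fourier_fourierInv_eq]

/-- The functional `v ↦ ∫ k (ξ - t) v t dt` on `L²`. -/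
def convFunctional (k : 𝓢(Rn n, ℂ)) (ξ : Rn n) : L2 n →L[ℂ] ℂ :=
  innerSL ℂ (Lp.compMeasurePreserving (fun t => ξ - t)
    (Measure.measurePreserving_sub_left volume ξ) (star (k.toLp 2 volume)))

lemma coeFn_compMeasurePreserving_toLp (k : 𝓢(Rn n, ℂ)) (ξ : Rn n) :
    (Lp.compMeasurePreserving (fun t => ξ - t)
      (Measure.measurePreserving_sub_left volume ξ) (star (k.toLp 2 volume)) : L2 n)
      =ᵐ[volume] fun t => star (k (ξ - t)) := by
  filter_upwards [Lp.coeFn_compMeasurePreserving (star (k.toLp 2 volume))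
      (Measure.measurePreserving_sub_left volume ξ),
    (Measure.measurePreserving_sub_left volume ξ).quasiMeasurePreserving.ae
      (Lp.coeFn_star (k.toLp 2 volume)),
    (Measure.measurePreserving_sub_left volume ξ).quasiMeasurePreserving.ae
      (k.coeFn_toLp 2 volume)] with t h1 h2 h3
  rw [h1, Function.comp_apply, h2, Pi.star_apply, h3]

lemma convFunctional_apply (k : 𝓢(Rn n, ℂ)) (ξ : Rn n) (v : L2 n) :
    convFunctional k ξ v = ∫ t, k (ξ - t) * v t := by
  rw [convFunctional, innerSL_apply_apply, L2.inner_def]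
  refine integral_congr_ae ?_
  filter_upwards [coeFn_compMeasurePreserving_toLp k ξ] with t h
  rw [h]
  simp [mul_comm]

lemma integrable_conv (k : 𝓢(Rn n, ℂ)) (ξ : Rn n) (v : L2 n) :
    Integrable fun t => k (ξ - t) * v t := by
  refine (L2.integrable_inner (𝕜 := ℂ) (Lp.compMeasurePreserving (fun t => ξ - t)
    (Measure.measurePreserving_sub_left volume ξ) (star (k.toLp 2 volume))) v).congr ?_
  filter_upwards [coeFn_compMeasurePreserving_toLp k ξ] with t h
  rw [h]
  simp [mul_comm]

lemma norm_convFunctional_le (k : 𝓢(Rn n, ℂ)) (ξ : Rn n) :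
    ‖convFunctional k ξ‖ ≤ ‖star (k.toLp 2 volume)‖ := by
  rw [convFunctional, innerSL_apply_norm, Lp.norm_compMeasurePreserving]

/-- Translation is continuous in L². This supplies the measurability needed to regard the truncated
family of functionals as an element of L². -/
lemma continuous_convFunctional (k : 𝓢(Rn n, ℂ)) : Continuous (convFunctional k) := by
  refine (innerSL ℂ).continuous.comp ?_
  exact Continuous.compMeasurePreservingLp (Z := Rn n) (f := fun _ => star (k.toLp 2 volume))
    (g := fun ξ => ⟨fun t => ξ - t, by fun_prop⟩) continuous_const
    (ContinuousMap.continuous_of_continuous_uncurry _ (by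
      simp only [Function.uncurry_def, ContinuousMap.coe_mk]; fun_prop))
    (fun ξ => Measure.measurePreserving_sub_left volume ξ) (by norm_num)

lemma memLp_indicator_of_bound {α F : Type*} [MeasurableSpace α] [NormedAddCommGroup F]
    {μ : Measure α} {p : ℝ≥0∞} {s : Set α} (hs : MeasurableSet s) (hμ : μ s < ∞) {f : α → F}
    (hf : AEStronglyMeasurable f μ) (C : ℝ) (hC : ∀ x, ‖f x‖ ≤ C) :
    MemLp (s.indicator f) p μ := by
  rw [memLp_indicator_iff_restrict hs]
  have : IsFiniteMeasure (μ.restrict s) := ⟨by simpa using hμ⟩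
  exact MemLp.of_bound hf.restrict C (Filter.Eventually.of_forall hC)

lemma memLp_indicator_convFunctional (k : 𝓢(Rn n, ℂ)) (R : ℝ) :
    MemLp ((Metric.closedBall (0 : Rn n) R).indicator (convFunctional k)) 2 volume :=
  memLp_indicator_of_bound Metric.isClosed_closedBall.measurableSet measure_closedBall_lt_top
    (continuous_convFunctional k).aestronglyMeasurable _ (norm_convFunctional_le k)

/-- The indicator function of a closed ball as an element of `L^∞`. -/
def ballIndicator (n : ℕ) (R : ℝ) : Linf n :=
  (memLp_indicator_const (μ := volume) ∞ (Metric.isClosed_closedBall (x := (0 : Rn n))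
    (ε := R)).measurableSet (1 : ℂ) (Or.inr measure_closedBall_lt_top.ne)).toLp _

lemma coeFn_ballIndicator (R : ℝ) : (ballIndicator n R : Rn n → ℂ) =ᵐ[volume]
    (Metric.closedBall (0 : Rn n) R).indicator fun _ => 1 :=
  MemLp.coeFn_toLp _

/-- Both sides are bounded operators, so it suffices to compare them on Schwartz functions, where
`freqMul k` is a genuine convolution. The truncation makes the bounded family of functionals square
integrable. -/
lemma ballIndicator_comp_freqMul (k : 𝓢(Rn n, ℂ)) (R : ℝ) :
    (mulOp (ballIndicator n R)).comp (freqMul k)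
      = hsOp volume ((memLp_indicator_convFunctional k R).toLp _) := by
  have hd : DenseRange (fun v : 𝓢(Rn n, ℂ) => v.toLp 2 volume) :=
    denseRange_toLpCLM (F := ℂ) (μ := (volume : Measure (Rn n))) (p := 2) (by norm_num)
  refine ContinuousLinearMap.ext fun v => ?_
  refine congrFun (hd.equalizer (ContinuousLinearMap.continuous _)
    (ContinuousLinearMap.continuous _) (funext fun v => ?_)) v
  simp only [Function.comp_apply, ContinuousLinearMap.comp_apply, freqMul_toLp]
  apply Lp.ext
  filter_upwards [coeFn_mulOp (ballIndicator n R)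
      ((convolution (ContinuousLinearMap.mul ℂ ℂ) k v).toLp 2), coeFn_ballIndicator (n := n) R,
    (convolution (ContinuousLinearMap.mul ℂ ℂ) k v).coeFn_toLp 2 volume,
    coeFn_hsOp volume ((memLp_indicator_convFunctional k R).toLp _) (v.toLp 2),
    (memLp_indicator_convFunctional k R).coeFn_toLp] with ξ h1 h2 h3 h4 h5
  rw [h1, h2, h3, h4, h5, convolution_apply, convolution_eq_swap]
  by_cases hξ : ξ ∈ Metric.closedBall (0 : Rn n) R
  · rw [Set.indicator_of_mem hξ, Set.indicator_of_mem hξ, one_mul, convFunctional_apply]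
    refine integral_congr_ae ?_
    filter_upwards [v.coeFn_toLp 2 volume] with t ht
    rw [ht]
    rfl
  · simp [hξ]

lemma isCompactOperator_ballIndicator_comp_freqMul (k : 𝓢(Rn n, ℂ)) (R : ℝ) :
    IsCompactOperator ((mulOp (ballIndicator n R)).comp (freqMul k)) := by
  rw [ballIndicator_comp_freqMul]
  exact isCompactOperator_hsOp _ _

lemma coeFn_freqMul (k : 𝓢(Rn n, ℂ)) (v : L2 n) :
    (freqMul k v : Rn n → ℂ) =ᵐ[volume] fun ξ => ∫ t, k (ξ - t) * v t := by
  -- The pointwise formula is known on each ball; countably many balls exhaust the space.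
  have h : ∀ᵐ ξ : Rn n, ∀ N : ℕ, ξ ∈ Metric.closedBall (0 : Rn n) N →
      freqMul k v ξ = ∫ t, k (ξ - t) * v t := by
    rw [ae_all_iff]
    intro N
    have e := congrArg (fun T : L2 n →L[ℂ] L2 n => T v) (ballIndicator_comp_freqMul k N)
    simp only [ContinuousLinearMap.comp_apply] at e
    filter_upwards [coeFn_mulOp (ballIndicator n N) (freqMul k v),
      coeFn_ballIndicator (n := n) N,
      coeFn_hsOp volume ((memLp_indicator_convFunctional k N).toLp _) v,
      (memLp_indicator_convFunctional k N).coeFn_toLp] with ξ h1 h2 h3 h4 hξ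
    rw [e, h3, h4, h2, Set.indicator_of_mem hξ, Set.indicator_of_mem hξ, one_mul,
      convFunctional_apply] at h1
    exact h1.symm
  filter_upwards [h] with ξ hξ
  obtain ⟨N, hN⟩ := exists_nat_ge ‖ξ‖
  exact hξ N (by simpa using hN)

end Convolution

/-- A function on `ℝⁿ` is slowly oscillating if its variation over balls of any fixed radius tends
to zero at infinity. -/
def SlowlyOscillating {n : ℕ} {K : Type*} [UniformSpace K] (f : Rn n → K) : Prop :=
  ∀ R : ℝ, ∀ V ∈ uniformity K, ∀ᶠ ξ in Filter.cocompact (Rn n),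
    ∀ h : Rn n, ‖h‖ ≤ R → (f ξ, f (ξ + h)) ∈ V

/-! ### Slowly oscillating symbols have compact commutators -/

section Commutator

open FourierTransform SchwartzMap

variable {n : ℕ}

lemma isCompactOperator_comp_left {A : L2 n →L[ℂ] L2 n} (hA : IsCompactOperator A)
    (B : L2 n →L[ℂ] L2 n) : IsCompactOperator (B.comp A) :=
  hA.clm_comp B

lemma isCompactOperator_comp_right {A : L2 n →L[ℂ] L2 n} (hA : IsCompactOperator A)
    (B : L2 n →L[ℂ] L2 n) : IsCompactOperator (A.comp B) :=
  hA.comp_clm B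

/-- The commutator of multiplication by `ψ` and convolution with `k` on the frequency side. -/
def freqComm (ψ : Linf n) (k : 𝓢(Rn n, ℂ)) : L2 n →L[ℂ] L2 n :=
  (mulOp ψ).comp (freqMul k) - (freqMul k).comp (mulOp ψ)

lemma coeFn_freqComm {ψ : Linf n} {f : Rn n → ℂ} (hf : ψ =ᵐ[volume] f) (k : 𝓢(Rn n, ℂ))
    (v : L2 n) : (freqComm ψ k v : Rn n → ℂ) =ᵐ[volume]
      fun ξ => ∫ t, k (ξ - t) * ((f ξ - f t) * v t) := by
  have e : freqComm ψ k v = mulOp ψ (freqMul k v) - freqMul k (mulOp ψ v) := rfl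
  rw [e]
  filter_upwards [Lp.coeFn_sub (mulOp ψ (freqMul k v)) (freqMul k (mulOp ψ v)),
    coeFn_mulOp ψ (freqMul k v), coeFn_freqMul k v, coeFn_freqMul k (mulOp ψ v), hf]
    with ξ h1 h2 h3 h4 h5
  rw [h1, Pi.sub_apply, h2, h3, h4, h5, ← integral_const_mul,
    ← integral_sub ((integrable_conv k ξ v).const_mul _) (integrable_conv k ξ (mulOp ψ v))]
  refine integral_congr_ae ?_
  filter_upwards [coeFn_mulOp ψ v, hf] with t h6 h7
  rw [h6, h7]
  ring

lemma norm_freqComm_sub_le {ψ : Linf n} {f : Rn n → ℂ} (hf : ψ =ᵐ[volume] f) {C : ℝ}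
    (hC : ∀ ξ, ‖f ξ‖ ≤ C) {R T ε : ℝ} (hR : 0 < R) (hε : 0 ≤ ε)
    (h : ∀ ξ, T < ‖ξ‖ → ∀ t, ‖ξ - t‖ ≤ R → ‖f ξ - f t‖ ≤ ε) (k : 𝓢(Rn n, ℂ)) :
    ‖freqComm ψ k - (mulOp (ballIndicator n T)).comp (freqComm ψ k)‖
      ≤ ε * (∫ t, ‖k t‖) + 2 * C / R * ∫ t, ‖t‖ * ‖k t‖ := by
  have hC0 : 0 ≤ C := (norm_nonneg _).trans (hC 0)
  have hi0 : Integrable (fun t => ‖k t‖) := k.integrable.norm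
  have hi1 : Integrable (fun t => ‖t‖ * ‖k t‖) := by simpa using k.integrable_pow_mul volume 1
  -- Majorant of the kernel for |ξ| > T: the oscillation of `f` is at most `ε` when |ξ - t| ≤ R, and
  -- otherwise at most 2C ≤ (2C/R)|ξ - t|. Young's inequality then bounds the norm by ∫ κ.
  set κ : Rn n → ℝ := fun t => ε * ‖k t‖ + 2 * C / R * (‖t‖ * ‖k t‖) with hκ
  have hκ0 : ∀ t, 0 ≤ κ t := fun t => by positivity
  have hκi : Integrable κ := (hi0.const_mul ε).add (hi1.const_mul (2 * C / R))
  have hκe : ∫ t, κ t = ε * (∫ t, ‖k t‖) + 2 * C / R * ∫ t, ‖t‖ * ‖k t‖ := by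
    rw [hκ, integral_add (hi0.const_mul ε) (hi1.const_mul (2 * C / R)), integral_const_mul,
      integral_const_mul]
  rw [← hκe]
  have hκm : Measurable κ := by
    have := k.continuous
    exact Continuous.measurable (by fun_prop)
  refine ContinuousLinearMap.opNorm_le_bound _ (integral_nonneg hκ0) fun v => ?_
  have key : ∀ ξ t, T < ‖ξ‖ → ‖k (ξ - t) * ((f ξ - f t) * v t)‖ₑ
      ≤ ENNReal.ofReal (κ (ξ - t)) * ‖v t‖ₑ := by
    intro ξ t hξ
    rw [← ofReal_norm, ← ofReal_norm, ← ENNReal.ofReal_mul (hκ0 _), norm_mul, norm_mul, ← mul_assoc]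
    gcongr
    have e : κ (ξ - t) = ‖k (ξ - t)‖ * (ε + 2 * C / R * ‖ξ - t‖) := by
      simp only [hκ]
      ring
    rw [e]
    gcongr
    rcases le_or_gt ‖ξ - t‖ R with h1 | h1
    · exact (h ξ hξ t h1).trans (le_add_of_nonneg_right (by positivity))
    · calc ‖f ξ - f t‖ ≤ ‖f ξ‖ + ‖f t‖ := norm_sub_le _ _
        _ ≤ 2 * C := by linarith [hC ξ, hC t]
        _ ≤ 2 * C / R * ‖ξ - t‖ := by
          rw [div_mul_eq_mul_div, le_div_iff₀ hR]
          gcongr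
        _ ≤ _ := le_add_of_nonneg_left hε
  have e : (freqComm ψ k - (mulOp (ballIndicator n T)).comp (freqComm ψ k)) v
      = freqComm ψ k v - mulOp (ballIndicator n T) (freqComm ψ k v) := rfl
  have hb := eLpNorm_two_le_of_enorm_le_conv volume (k := fun t => ENNReal.ofReal (κ t))
    (f := (freqComm ψ k - (mulOp (ballIndicator n T)).comp (freqComm ψ k)) v) (v := v)
    hκm.ennreal_ofReal (Lp.aestronglyMeasurable v) (by
      rw [e]
      filter_upwards [Lp.coeFn_sub (freqComm ψ k v) (mulOp (ballIndicator n T) (freqComm ψ k v)),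
        coeFn_mulOp (ballIndicator n T) (freqComm ψ k v), coeFn_ballIndicator (n := n) T,
        coeFn_freqComm hf k v] with ξ h1 h2 h3 h4
      rw [h1, Pi.sub_apply, h2, h3]
      rcases le_or_gt ‖ξ‖ T with hξ | hξ
      · rw [Set.indicator_of_mem (by simpa using hξ)]
        simp
      · rw [Set.indicator_of_notMem (by simpa using hξ), zero_mul, sub_zero, h4]
        exact (enorm_integral_le_lintegral_enorm _).trans (lintegral_mono fun t => key ξ t hξ))
  rw [← ofReal_integral_eq_lintegral_ofReal hκi (Filter.Eventually.of_forall hκ0)] at hb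
  rw [Lp.norm_def, Lp.norm_def]
  have := ENNReal.toReal_mono (ENNReal.mul_ne_top ENNReal.ofReal_ne_top (Lp.eLpNorm_ne_top v)) hb
  rwa [ENNReal.toReal_mul, ENNReal.toReal_ofReal (integral_nonneg hκ0)] at this

/-- The cutoff commutes with multiplication by `ψ`, so both terms contain the compact truncated
convolution. -/
lemma isCompactOperator_ballIndicator_comp_freqComm (ψ : Linf n) (k : 𝓢(Rn n, ℂ)) (T : ℝ) :
    IsCompactOperator ((mulOp (ballIndicator n T)).comp (freqComm ψ k)) := by
  have e : (mulOp (ballIndicator n T)).comp (freqComm ψ k)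
      = (mulOp ψ).comp ((mulOp (ballIndicator n T)).comp (freqMul k))
        - ((mulOp (ballIndicator n T)).comp (freqMul k)).comp (mulOp ψ) := by
    rw [freqComm, ContinuousLinearMap.comp_sub, ← ContinuousLinearMap.comp_assoc, ← mulOp_mul,
      mul_comm, mulOp_mul]
    rfl
  rw [e]
  have h := isCompactOperator_ballIndicator_comp_freqMul k T
  exact (isCompactOperator_comp_left h (mulOp ψ)).sub (isCompactOperator_comp_right h (mulOp ψ))

lemma eventually_cocompact_iff {p : Rn n → Prop} :
    (∀ᶠ ξ in Filter.cocompact (Rn n), p ξ) ↔ ∃ T : ℝ, ∀ ξ, T < ‖ξ‖ → p ξ := by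
  rw [← Metric.cobounded_eq_cocompact,
    (Metric.hasBasis_cobounded_compl_closedBall (0 : Rn n)).eventually_iff]
  simp

lemma isCompactOperator_freqComm {ψ : Linf n} {f : Rn n → ℂ} (hf : ψ =ᵐ[volume] f) {C : ℝ}
    (hC : ∀ ξ, ‖f ξ‖ ≤ C) (hso : SlowlyOscillating f) (k : 𝓢(Rn n, ℂ)) :
    IsCompactOperator (freqComm ψ k) := by
  have hC0 : 0 ≤ C := (norm_nonneg _).trans (hC 0)
  refine isClosed_setOfPred_isCompactOperator.closure_subset
    (Metric.mem_closure_iff.2 fun δ hδ => ?_ :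
      freqComm ψ k ∈ closure {T : L2 n →L[ℂ] L2 n | IsCompactOperator T})
  set a := ∫ t, ‖k t‖
  set b := ∫ t, ‖t‖ * ‖k t‖
  have ha : 0 ≤ a := integral_nonneg fun t => norm_nonneg _
  have hb : 0 ≤ b := integral_nonneg fun t => by positivity
  -- With these choices each of the two terms of the tail bound is at most δ/4; the added ones keep
  -- `ε` defined and `R` positive even when `a` or `b` vanishes.
  set ε := δ / (4 * (a + 1))
  set R := 4 * (2 * C * b + 1) / δ
  have hε : 0 < ε := by positivity
  have hR : 0 < R := by positivity
  obtain ⟨T, hT⟩ := eventually_cocompact_iff.1 (hso R _ (Metric.dist_mem_uniformity hε))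
  refine ⟨_, isCompactOperator_ballIndicator_comp_freqComm ψ k T, ?_⟩
  rw [dist_eq_norm]
  refine (norm_freqComm_sub_le hf hC hR hε.le (T := T) (fun ξ hξ t ht => ?_) k).trans_lt ?_
  · have := hT ξ hξ (t - ξ) (by rwa [norm_sub_rev])
    rw [add_sub_cancel] at this
    rw [← dist_eq_norm]
    exact le_of_lt this
  · have h1 : ε * a ≤ δ / 4 := by
      rw [div_mul_eq_mul_div, div_le_div_iff₀ (by positivity) (by positivity)]
      nlinarith
    have h2 : 2 * C / R * b ≤ δ / 4 := by
      have : 2 * C / R * b = 2 * C * b / (2 * C * b + 1) * (δ / 4) := by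
        simp only [R]
        field_simp
      rw [this]
      refine mul_le_of_le_one_left (by positivity) ?_
      rw [div_le_one (by positivity)]
      linarith
    linarith

/-- The commutator of `A_ψ` and multiplication by `b ∈ L^∞`. -/
def genComm (ψ : Linf n) (b : Linf n) : L2 n →L[ℂ] L2 n :=
  (opA ψ).comp (mulOp b) - (mulOp b).comp (opA ψ)

/-- Continuity in the multiplier reduces compactly supported continuous Φ to Schwartz functions,
since compactness survives norm limits. -/
lemma continuous_genComm (ψ : Linf n) : Continuous (genComm ψ) := by
  have h : Continuous (mulOp : Linf n → _) :=
    ((ContinuousLinearMap.mul ℂ ℂ).holderL volume ∞ 2 2).continuous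
  unfold genComm
  exact (continuous_const.clm_comp h).sub (h.clm_comp continuous_const)

lemma genComm_fourierInv (ψ : Linf n) (k : 𝓢(Rn n, ℂ)) :
    genComm ψ ((𝓕⁻ k : 𝓢(Rn n, ℂ)).toLp ∞ volume)
      = ((fourierOp n).symm.toContinuousLinearEquiv : L2 n →L[ℂ] L2 n).comp
        ((freqComm ψ k).comp ((fourierOp n).toContinuousLinearEquiv : L2 n →L[ℂ] L2 n)) := by
  ext1 u
  simp [genComm, freqComm, freqMul, opA]

lemma isCompactOperator_genComm_schwartz {ψ : Linf n} {f : Rn n → ℂ} (hf : ψ =ᵐ[volume] f)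
    {C : ℝ} (hC : ∀ ξ, ‖f ξ‖ ≤ C) (hso : SlowlyOscillating f) (φ : 𝓢(Rn n, ℂ)) :
    IsCompactOperator (genComm ψ (φ.toLp ∞ volume)) := by
  have e := genComm_fourierInv ψ (𝓕 φ)
  rw [fourierInv_fourier_eq] at e
  rw [e]
  exact isCompactOperator_comp_left
    (isCompactOperator_comp_right (isCompactOperator_freqComm hf hC hso (𝓕 φ)) _) _

/-- A uniform smooth approximation is multiplied by a bump equal to 1 on the support of Φ; this
makes it compactly supported without increasing the error. -/
lemma ofCc_mem_closure (Φ : CompactlySupportedContinuousMap (Rn n) ℂ) :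
    ofCc Φ ∈ closure (Set.range fun φ : 𝓢(Rn n, ℂ) => φ.toLp ∞ volume) := by
  refine Metric.mem_closure_iff.2 fun ε hε => ?_
  obtain ⟨g, hg, hgΦ⟩ := (Φ.hasCompactSupport.uniformContinuous_of_continuous
    Φ.continuous).exists_contDiff_dist_le (half_pos hε)
  obtain ⟨r, hr0, hr⟩ : ∃ r : ℝ, 0 < r ∧ tsupport Φ ⊆ Metric.closedBall 0 r := by
    obtain ⟨r, hr⟩ := Φ.hasCompactSupport.isCompact.isBounded.subset_closedBall 0
    exact ⟨max r 1, by positivity, hr.trans (Metric.closedBall_subset_closedBall (le_max_left _ _))⟩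
  let χ : ContDiffBump (0 : Rn n) := ⟨r, r + 1, hr0, by linarith⟩
  have hs : HasCompactSupport fun x => χ x • g x := χ.hasCompactSupport.smul_right
  have hd : ContDiff ℝ (⊤ : ℕ∞) fun x => χ x • g x := χ.contDiff.smul hg
  refine ⟨_, ⟨hs.toSchwartzMap hd, rfl⟩, ?_⟩
  rw [dist_eq_norm]
  refine (Linf.norm_le _ (half_pos hε).le ?_).trans_lt (half_lt_self hε)
  filter_upwards [Lp.coeFn_sub (ofCc Φ) ((hs.toSchwartzMap hd).toLp ∞ volume),
    (Φ.continuous.memLp_top_of_hasCompactSupport Φ.hasCompactSupport volume).coeFn_toLp,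
    (hs.toSchwartzMap hd).coeFn_toLp ∞ volume] with x h1 h2 h3
  have h2' : ofCc Φ x = Φ x := h2
  rw [h1, Pi.sub_apply, h2', h3]
  change ‖Φ x - χ x • g x‖ ≤ ε / 2
  have h4 : Φ x = χ x • Φ x := by
    by_cases hx : x ∈ tsupport Φ
    · rw [χ.one_of_mem_closedBall (hr hx), one_smul]
    · rw [image_eq_zero_of_notMem_tsupport hx, smul_zero]
  rw [h4, ← smul_sub, norm_smul, Real.norm_of_nonneg χ.nonneg, ← dist_eq_norm, dist_comm]
  exact (mul_le_of_le_one_left dist_nonneg χ.le_one).trans (hgΦ x).le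

/-- Bounded slowly oscillating functions are admissible symbols. -/
theorem mem_symbolAlg_of_slowlyOscillating {ψ : Linf n} {f : Rn n → ℂ} (hf : ψ =ᵐ[volume] f)
    {C : ℝ} (hC : ∀ ξ, ‖f ξ‖ ≤ C) (hso : SlowlyOscillating f) : ψ ∈ symbolAlg n := by
  intro Φ
  have hcl : IsClosed {b : Linf n | IsCompactOperator (genComm ψ b)} :=
    isClosed_setOfPred_isCompactOperator.preimage (continuous_genComm ψ)
  exact closure_minimal (by
    rintro _ ⟨φ, rfl⟩
    exact isCompactOperator_genComm_schwartz hf hC hso φ) hcl (ofCc_mem_closure Φ)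

end Commutator

/-! ### Stability of slow oscillation -/

section SlowOscillation

open Filter Topology

variable {n : ℕ}

lemma slowlyOscillating_iff_tendsto {K : Type*} [UniformSpace K] {f : Rn n → K} :
    SlowlyOscillating f ↔ ∀ R : ℝ, Tendsto (fun q : Rn n × Rn n => (f q.1, f (q.1 + q.2)))
      (cocompact (Rn n) ×ˢ 𝓟 (Metric.closedBall 0 R)) (uniformity K) := by
  refine forall_congr' fun R => forall₂_congr fun V hV => ?_
  have := eventually_prod_principal_iff (f := cocompact (Rn n)) (s := Metric.closedBall (0 : Rn n) R)
    (p := fun q => (f q.1, f (q.1 + q.2)) ∈ V)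
  simp only [mem_closedBall_zero_iff] at this
  exact this.symm

lemma SlowlyOscillating.comp {K L : Type*} [UniformSpace K] [UniformSpace L] {f : Rn n → K}
    (hf : SlowlyOscillating f) {g : K → L} (hg : UniformContinuous g) :
    SlowlyOscillating (g ∘ f) := by
  rw [slowlyOscillating_iff_tendsto] at hf ⊢
  exact fun R => Tendsto.comp hg (hf R)

/-- The index set may be infinite, because the product uniformity is the infimum of the pulled-back
ones. This is what allows all subspaces to be treated together. -/
lemma SlowlyOscillating.pi {ι : Type*} {K : ι → Type*} [∀ i, UniformSpace (K i)]
    {f : Rn n → ∀ i, K i} (hf : ∀ i, SlowlyOscillating fun ξ => f ξ i) :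
    SlowlyOscillating f := by
  rw [slowlyOscillating_iff_tendsto]
  intro R
  rw [Pi.uniformity, tendsto_iInf]
  exact fun i => tendsto_comap_iff.2 (slowlyOscillating_iff_tendsto.1 (hf i) R)

end SlowOscillation

/-! ### Anisotropic dilations and slow oscillation of π_X -/

section Aniso

open Filter Topology

variable {n : ℕ} (X : Submodule ℝ (Rn n))

/-- The anisotropic dilation `ξ ↦ s² ξ̃ + s ξ̄`. -/
def anisoDil (s : ℝ) : Rn n →L[ℝ] Rn n := s ^ 2 • X.starProjection + s • Xᗮ.starProjection

lemma anisoDil_apply (s : ℝ) (ξ : Rn n) :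
    anisoDil X s ξ = s ^ 2 • X.starProjection ξ + s • Xᗮ.starProjection ξ := rfl

lemma starProjection_smul_add_smul (a b : ℝ) (ξ : Rn n) :
    X.starProjection (a • X.starProjection ξ + b • Xᗮ.starProjection ξ)
      = a • X.starProjection ξ := by
  rw [map_add, map_smul, map_smul,
    Submodule.starProjection_eq_self_iff.2 (X.starProjection_apply_mem ξ),
    (Submodule.starProjection_apply_eq_zero_iff X).2 (Xᗮ.starProjection_apply_mem ξ), smul_zero,
    add_zero]

lemma starProjection_orthogonal_smul_add_smul (a b : ℝ) (ξ : Rn n) :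
    Xᗮ.starProjection (a • X.starProjection ξ + b • Xᗮ.starProjection ξ)
      = b • Xᗮ.starProjection ξ := by
  rw [map_add, map_smul, map_smul,
    Submodule.starProjection_eq_self_iff.2 (Xᗮ.starProjection_apply_mem ξ),
    (Submodule.starProjection_apply_eq_zero_iff Xᗮ).2
      (X.le_orthogonal_orthogonal (X.starProjection_apply_mem ξ)), smul_zero, zero_add]

lemma anisoWeight_nonneg (ξ : Rn n) : 0 ≤ anisoWeight X ξ := by
  unfold anisoWeight
  positivity

lemma anisoWeight_anisoDil {s : ℝ} (hs : 0 ≤ s) (ξ : Rn n) :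
    anisoWeight X (anisoDil X s ξ) = s ^ 4 * anisoWeight X ξ := by
  rw [anisoWeight, anisoDil_apply, starProjection_smul_add_smul,
    starProjection_orthogonal_smul_add_smul, norm_smul, norm_smul, norm_pow,
    Real.norm_of_nonneg hs, anisoWeight]
  ring

lemma anisoProj_anisoDil {s : ℝ} (hs : 0 < s) (ξ : Rn n) :
    anisoProj X (anisoDil X s ξ) = anisoProj X ξ := by
  have h2 : (s ^ 4 * anisoWeight X ξ) ^ (1 / 2 : ℝ) = s ^ 2 * anisoWeight X ξ ^ (1 / 2 : ℝ) := by
    rw [Real.mul_rpow (by positivity) (anisoWeight_nonneg X ξ), ← Real.rpow_natCast,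
      ← Real.rpow_mul hs.le]
    norm_num
  have h4 : (s ^ 4 * anisoWeight X ξ) ^ (1 / 4 : ℝ) = s * anisoWeight X ξ ^ (1 / 4 : ℝ) := by
    rw [Real.mul_rpow (by positivity) (anisoWeight_nonneg X ξ), ← Real.rpow_natCast,
      ← Real.rpow_mul hs.le]
    norm_num
  rw [anisoProj, anisoWeight_anisoDil X hs.le, h2, h4, anisoDil_apply,
    starProjection_smul_add_smul, starProjection_orthogonal_smul_add_smul, smul_smul, smul_smul,
    anisoProj]
  congr 2
  · field_simp
  · field_simp

lemma anisoProj_eq_anisoDil (ξ : Rn n) :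
    anisoProj X ξ = anisoDil X (anisoWeight X ξ ^ (1 / 4 : ℝ))⁻¹ ξ := by
  have h : (anisoWeight X ξ ^ (1 / 4 : ℝ)) ^ 2 = anisoWeight X ξ ^ (1 / 2 : ℝ) := by
    rw [← Real.rpow_natCast, ← Real.rpow_mul (anisoWeight_nonneg X ξ)]
    norm_num
  rw [anisoDil_apply, inv_pow, h, anisoProj]

/-- The dilation normalizing ξ does not change π_X; applied to ξ + h it moves the base point to S_X
and contracts the shift. -/
lemma anisoProj_add {ξ : Rn n} (hξ : ξ ≠ 0) (h : Rn n) :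
    anisoProj X (ξ + h)
      = anisoProj X (anisoProj X ξ + anisoDil X (anisoWeight X ξ ^ (1 / 4 : ℝ))⁻¹ h) := by
  have hs := inv_pos.2 (Real.rpow_pos_of_pos (anisoWeight_pos X hξ) (1 / 4))
  conv_lhs => rw [← anisoProj_anisoDil X hs, map_add, ← anisoProj_eq_anisoDil]

lemma tendsto_anisoWeight : Tendsto (anisoWeight X) (cocompact (Rn n)) atTop := by
  have h : ∀ ξ : Rn n, (‖ξ‖ ^ 2 - 1) / 2 ≤ anisoWeight X ξ := fun ξ => by
    have h1 : ‖ξ‖ ^ 2 = ‖X.starProjection ξ‖ ^ 2 + ‖Xᗮ.starProjection ξ‖ ^ 2 :=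
      Submodule.norm_sq_eq_add_norm_sq_starProjection ξ X
    rw [anisoWeight, h1]
    nlinarith [sq_nonneg (‖Xᗮ.starProjection ξ‖ ^ 2 - 1), sq_nonneg ‖X.starProjection ξ‖]
  refine tendsto_atTop_mono h ?_
  refine Tendsto.atTop_div_const two_pos (tendsto_atTop_add_const_right _ _ ?_)
  exact (tendsto_pow_atTop two_ne_zero).comp (tendsto_norm_cocompact_atTop (E := Rn n))

lemma tendsto_inv_anisoWeight_rpow {r : ℝ} (hr : 0 < r) :
    Tendsto (fun ξ => (anisoWeight X ξ ^ r)⁻¹) (cocompact (Rn n)) (𝓝 0) :=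
  tendsto_inv_atTop_zero.comp ((tendsto_rpow_atTop hr).comp (tendsto_anisoWeight X))

lemma continuousAt_anisoProj {ξ : Rn n} (hξ : ξ ≠ 0) : ContinuousAt (anisoProj X) ξ := by
  have hw : Continuous (anisoWeight X) := by
    unfold anisoWeight
    fun_prop
  have hp : ∀ r : ℝ, ContinuousAt (fun ξ => (anisoWeight X ξ ^ r)⁻¹) ξ := fun r =>
    (hw.continuousAt.rpow_const (Or.inl (anisoWeight_pos X hξ).ne')).inv₀
      (Real.rpow_pos_of_pos (anisoWeight_pos X hξ) r).ne'
  unfold anisoProj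
  exact ((hp _).smul (by fun_prop)).add ((hp _).smul (by fun_prop))

lemma ne_zero_of_mem_anisoSphere {ξ : Rn n} (h : ξ ∈ anisoSphere X) : ξ ≠ 0 := by
  rintro rfl
  have h' : anisoWeight X 0 = 1 := h
  simp [anisoWeight] at h'

lemma eventually_dist_anisoProj_lt (R : ℝ) {ε : ℝ} (hε : 0 < ε) :
    ∀ᶠ ξ in cocompact (Rn n), ∀ h : Rn n, ‖h‖ ≤ R →
      dist (anisoProj X ξ) (anisoProj X (ξ + h)) < ε := by
  have hS : IsCompact (anisoSphere X) := isCompact_iff_compactSpace.2 inferInstance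
  -- Only one of the two compared points has to lie on the compact set S_X; the perturbed point
  -- usually does not.
  obtain ⟨δ, hδ, hδ'⟩ := Metric.mem_uniformity_dist.1
    (hS.uniformContinuousAt_of_continuousAt (anisoProj X)
      (fun a ha => continuousAt_anisoProj X (ne_zero_of_mem_anisoSphere X ha))
      (Metric.dist_mem_uniformity hε))
  have hs : Tendsto (fun ξ : Rn n => (((anisoWeight X ξ ^ (1 / 4 : ℝ))⁻¹) ^ 2
      + (anisoWeight X ξ ^ (1 / 4 : ℝ))⁻¹) * |R|) (cocompact (Rn n)) (𝓝 0) := by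
    have := tendsto_inv_anisoWeight_rpow X (r := 1 / 4) (by norm_num)
    simpa using ((this.pow 2).add this).mul_const |R|
  have hne : ∀ᶠ ξ in cocompact (Rn n), ξ ≠ 0 := by
    filter_upwards [(tendsto_norm_cocompact_atTop (E := Rn n)).eventually_gt_atTop 0] with ξ hξ
    exact norm_pos_iff.1 hξ
  filter_upwards [hs.eventually_lt_const hδ, hne] with ξ h1 hξ h hh
  -- The zero shift yields idempotence of π_X, so both terms of the distance are values of π_X at
  -- points close to S_X.
  have e := anisoProj_add X hξ 0
  rw [map_zero, add_zero, add_zero] at e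
  rw [anisoProj_add X hξ h]
  suffices hd : dist (anisoProj X ξ)
      (anisoProj X ξ + anisoDil X (anisoWeight X ξ ^ (1 / 4 : ℝ))⁻¹ h) < δ by
    have := hδ' hd (anisoProj_mem X hξ)
    rwa [← e] at this
  rw [dist_eq_norm, sub_add_cancel_left, norm_neg]
  refine lt_of_le_of_lt ?_ h1
  have hs0 : 0 ≤ (anisoWeight X ξ ^ (1 / 4 : ℝ))⁻¹ :=
    inv_nonneg.2 (Real.rpow_nonneg (anisoWeight_nonneg X ξ) _)
  have hh' : ‖h‖ ≤ |R| := hh.trans (le_abs_self R)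
  rw [anisoDil_apply, add_mul]
  refine (norm_add_le _ _).trans ?_
  rw [norm_smul, norm_smul, norm_pow, Real.norm_of_nonneg hs0]
  gcongr
  · exact (X.norm_starProjection_apply_le h).trans hh'
  · exact (Xᗮ.norm_starProjection_apply_le h).trans hh'

open Classical in
/-- The projection `π_X` with the value at the origin set to `π_X e`. -/
def anisoExt (e : {ξ : Rn n // ξ ≠ 0}) (ξ : Rn n) : anisoSphere X :=
  if h : ξ ≠ 0 then anisoProjTo X ⟨ξ, h⟩ else anisoProjTo X e

lemma coe_anisoExt (e : {ξ : Rn n // ξ ≠ 0}) {ξ : Rn n} (hξ : ξ ≠ 0) :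
    (anisoExt X e ξ : Rn n) = anisoProj X ξ := by
  rw [anisoExt, dif_pos hξ]
  rfl

lemma slowlyOscillating_anisoExt (e : {ξ : Rn n // ξ ≠ 0}) :
    SlowlyOscillating (anisoExt X e) := by
  intro R V hV
  obtain ⟨ε, hε, hV⟩ := Metric.mem_uniformity_dist.1 hV
  filter_upwards [eventually_dist_anisoProj_lt X R hε,
    (tendsto_norm_cocompact_atTop (E := Rn n)).eventually_gt_atTop (max R 0)] with ξ h1 h2 h hh
  have h0 : ξ ≠ 0 := norm_pos_iff.1 ((le_max_right _ _).trans_lt h2)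
  have h3 : ξ + h ≠ 0 := fun h4 => by
    rw [eq_neg_of_add_eq_zero_left h4, norm_neg] at h2
    exact absurd (hh.trans (le_max_left R 0)) h2.not_ge
  refine hV ?_
  rw [Subtype.dist_eq, coe_anisoExt X e h0, coe_anisoExt X e h3]
  exact h1 h hh

lemma continuousOn_anisoExt (e : {ξ : Rn n // ξ ≠ 0}) : ContinuousOn (anisoExt X e) {0}ᶜ := by
  rw [continuousOn_iff_continuous_domRestrict]
  exact Continuous.congr (f := fun ξ : ↥({0}ᶜ : Set (Rn n)) => anisoProjTo X ⟨ξ, ξ.2⟩)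
    (continuous_anisoProjTo X) fun ξ =>
      Subtype.ext (coe_anisoExt X e ξ.2).symm

end Aniso

/-! ### Characters restricted to functions of a slowly oscillating map -/

section SymbolHom

open Filter Topology

variable {n : ℕ} {K : Type*} [UniformSpace K] [CompactSpace K] {f : Rn n → K}

lemma memLp_comp_of_continuousOn (hc : ContinuousOn f {0}ᶜ) (H : C(K, ℂ)) :
    MemLp (H ∘ f) ∞ (volume : Measure (Rn n)) :=
  memLp_top_of_bound
    (measurable_of_continuousOn_compl_singleton 0
      (H.continuous.comp_continuousOn hc)).aestronglyMeasurable ‖H‖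
    (Eventually.of_forall fun ξ => H.norm_coe_le_norm (f ξ))

/-- The homomorphism `H ↦ H ∘ f` from `C(K)` to `L^∞`. -/
def compLinf (hc : ContinuousOn f {0}ᶜ) : C(K, ℂ) →ₐ[ℂ] Linf n where
  toFun H := (memLp_comp_of_continuousOn hc H).toLp _
  map_one' := by
    apply Lp.ext
    filter_upwards [(memLp_comp_of_continuousOn hc 1).coeFn_toLp, Linf.coeFn_one (n := n)]
      with ξ h1 h2
    rw [h1, h2]
    rfl
  map_mul' H L := by
    apply Lp.ext
    filter_upwards [(memLp_comp_of_continuousOn hc (H * L)).coeFn_toLp,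
      (memLp_comp_of_continuousOn hc H).coeFn_toLp, (memLp_comp_of_continuousOn hc L).coeFn_toLp,
      Linf.coeFn_mul ((memLp_comp_of_continuousOn hc H).toLp _)
        ((memLp_comp_of_continuousOn hc L).toLp _)] with ξ h1 h2 h3 h4
    rw [h1, h4, h2, h3]
    rfl
  map_zero' := rfl
  map_add' H L := rfl
  commutes' c := by
    apply Lp.ext
    rw [Algebra.algebraMap_eq_smul_one (A := Linf n)]
    filter_upwards [(memLp_comp_of_continuousOn hc (algebraMap ℂ C(K, ℂ) c)).coeFn_toLp,
      Lp.coeFn_smul c (1 : Linf n), Linf.coeFn_one (n := n)] with ξ h1 h2 h3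
    rw [h1, h2, Pi.smul_apply, h3]
    simp

lemma coeFn_compLinf (hc : ContinuousOn f {0}ᶜ) (H : C(K, ℂ)) :
    (compLinf hc H : Rn n → ℂ) =ᵐ[volume] H ∘ f :=
  (memLp_comp_of_continuousOn hc H).coeFn_toLp

lemma compLinf_mem_symbolAlg (hc : ContinuousOn f {0}ᶜ) (hf : SlowlyOscillating f)
    (H : C(K, ℂ)) : compLinf hc H ∈ symbolAlg n :=
  mem_symbolAlg_of_slowlyOscillating (coeFn_compLinf hc H)
    (fun ξ => H.norm_coe_le_norm (f ξ))
    (hf.comp (CompactSpace.uniformContinuous_of_continuous H.continuous))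

/-- The homomorphism `H ↦ H ∘ f` from `C(K)` to the algebra of admissible symbols. -/
def compSymbol (hc : ContinuousOn f {0}ᶜ) (hf : SlowlyOscillating f) :
    C(K, ℂ) →ₐ[ℂ] symbolAlg n :=
  (compLinf hc).codRestrict (symbolAlg n) (compLinf_mem_symbolAlg hc hf)

/-- A character of `𝒜` restricts to a point evaluation on `C(K)`, at a cluster point of `f` at
infinity. -/
theorem exists_eval_mapClusterPt [T2Space K] (η : SymbolSpectrum n) (hc : ContinuousOn f {0}ᶜ)
    (hf : SlowlyOscillating f) : ∃ p : K,
      (∀ H : C(K, ℂ), η (Ideal.Quotient.mk (vanishingIdeal n) (compSymbol hc hf H)) = H p) ∧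
      MapClusterPt p (cocompact (Rn n)) f := by
  let χ : C(K, ℂ) →ₐ[ℂ] ℂ := (WeakDual.CharacterSpace.toAlgHom η).comp
    ((Ideal.Quotient.mkₐ ℂ (vanishingIdeal n)).comp (compSymbol hc hf))
  obtain ⟨p, hp⟩ := (WeakDual.CharacterSpace.homeoEval K ℂ).surjective
    (WeakDual.CharacterSpace.equivAlgHom.symm χ)
  have hp' : ∀ H : C(K, ℂ),
      η (Ideal.Quotient.mk (vanishingIdeal n) (compSymbol hc hf H)) = H p := fun H =>
    (DFunLike.congr_fun hp H).symm
  refine ⟨p, hp', ?_⟩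
  by_contra hcl
  rw [mapClusterPt_iff_frequently] at hcl
  push Not at hcl
  obtain ⟨U, hU, hfU⟩ := hcl
  obtain ⟨W, hWU, hW, hpW⟩ := mem_nhds_iff.1 hU
  -- If p were not a cluster point, a Urysohn function equal to 1 at p and 0 off a neighbourhood
  -- that `f` eventually avoids would give a symbol in the vanishing ideal on which η takes the
  -- value 1.
  obtain ⟨g, hg0, hg1, -⟩ := exists_continuous_zero_one_of_isClosed hW.isClosed_compl
    (isClosed_singleton (x := p)) (by simpa using hpW)
  let H : C(K, ℂ) := ⟨fun x => (g x : ℂ), by fun_prop⟩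
  have hH : compSymbol hc hf H ∈ vanishingIdeal n := by
    intro ε hε
    obtain ⟨T, hT⟩ := eventually_cocompact_iff.1 hfU
    refine ⟨T, ?_⟩
    filter_upwards [coeFn_compLinf hc H] with ξ h1 h2
    have h3 : g (f ξ) = 0 := hg0 fun h4 => hT ξ h2 (hWU h4)
    change ‖compLinf hc H ξ‖ ≤ ε
    rw [h1]
    simp [H, h3, hε.le]
  have h0 := hp' H
  rw [Ideal.Quotient.eq_zero_iff_mem.2 hH, map_zero] at h0
  have h1 : g p = 1 := hg1 rfl
  simp [H, h1] at h0

end SymbolHom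

/-! ### One ultrafilter realizing all the projections p_X(η) -/

section Spectrum

open Filter Topology

variable {n : ℕ}

/-- In dimension zero the symbol 1 vanishes at infinity vacuously, so 𝒜 has no characters. -/
lemma exists_ne_zero_of_spectrum (η : SymbolSpectrum n) : ∃ e : Rn n, e ≠ 0 := by
  by_contra! h
  have h1 : (1 : symbolAlg n) ∈ vanishingIdeal n := fun ε hε =>
    ⟨0, Eventually.of_forall fun ξ hξ => by simp [h ξ] at hξ⟩
  have h2 := map_one (WeakDual.CharacterSpace.toAlgHom η)
  rw [← map_one (Ideal.Quotient.mk (vanishingIdeal n)), Ideal.Quotient.eq_zero_iff_mem.2 h1,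
    map_zero] at h2
  exact zero_ne_one h2

/-- The joint projection to all the manifolds `S_X`. -/
def anisoJoint (e : {ξ : Rn n // ξ ≠ 0}) (ξ : Rn n) (X : Submodule ℝ (Rn n)) : anisoSphere X :=
  anisoExt X e ξ

theorem exists_ultrafilter_of_spectrum (η : SymbolSpectrum n) :
    ∃ p : (X : Submodule ℝ (Rn n)) → anisoSphere X,
      (∀ X s, IsSpectralProjection η X s ↔ s = p X) ∧
      ∃ U : Ultrafilter (Rn n), (U : Filter (Rn n)) ≤ cocompact (Rn n) ∧
        ∀ X, Tendsto (anisoProj X) U (𝓝 (p X : Rn n)) := by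
  obtain ⟨e, he⟩ := exists_ne_zero_of_spectrum η
  have : Nontrivial (Rn n) := ⟨e, 0, he⟩
  have hc : ContinuousOn (anisoJoint ⟨e, he⟩) {0}ᶜ :=
    continuousOn_pi.2 fun X => continuousOn_anisoExt X ⟨e, he⟩
  have hf : SlowlyOscillating (anisoJoint ⟨e, he⟩) :=
    SlowlyOscillating.pi fun X => slowlyOscillating_anisoExt X ⟨e, he⟩
  obtain ⟨p, hp, hcl⟩ := exists_eval_mapClusterPt η hc hf
  have hpX : ∀ X, IsSpectralProjection η X (p X) := by
    intro X ψ
    let H : C((X : Submodule ℝ (Rn n)) → anisoSphere X, ℂ) :=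
      ψ.comp ⟨fun q => q X, continuous_apply X⟩
    have h1 : compLinf hc H = quasiHom X ψ := by
      apply Lp.ext
      filter_upwards [coeFn_compLinf hc H, (quasiHomFun_memLp X ψ).coeFn_toLp,
        Measure.ae_ne volume (0 : Rn n)] with ξ h1 h2 h3
      have h2' : quasiHom X ψ ξ = quasiHomFun X ψ ξ := h2
      rw [h1, h2', quasiHomFun, dif_pos h3]
      change ψ (anisoExt X ⟨e, he⟩ ξ) = _
      rw [anisoExt, dif_pos h3]
    have h2 : quasiHom X ψ ∈ symbolAlg n := h1 ▸ compLinf_mem_symbolAlg hc hf H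
    refine ⟨h2, ?_⟩
    have h3 : compSymbol hc hf H = ⟨quasiHom X ψ, h2⟩ := Subtype.ext h1
    rw [← h3]
    exact hp H
  refine ⟨p, fun X s => ⟨fun hs => ?_, fun hs => hs ▸ hpX X⟩, ?_⟩
  · let ψ : C(anisoSphere X, ℂ) := ⟨fun x => (dist x (p X) : ℂ), by fun_prop⟩
    obtain ⟨_, h1⟩ := hs ψ
    obtain ⟨_, h2⟩ := hpX X ψ
    have h3 := h1.symm.trans h2
    simpa [ψ] using h3
  · obtain ⟨U, hU, hUp⟩ := mapClusterPt_iff_ultrafilter.1 hcl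
    refine ⟨U, hU, fun X => ?_⟩
    have h1 := (continuous_subtype_val.tendsto _).comp ((tendsto_pi_nhds.1 hUp) X)
    refine h1.congr' ?_
    filter_upwards [hU ((tendsto_norm_cocompact_atTop (E := Rn n)).eventually_gt_atTop 0)] with ξ hξ
    exact coe_anisoExt X _ (norm_pos_iff.1 hξ)

end Spectrum

/-! ### Successive asymptotic directions along an ultrafilter -/

section Flag

open Filter Topology
open scoped RealInnerProductSpace

variable {E : Type*} [NormedAddCommGroup E] [InnerProductSpace ℝ E] (U : Ultrafilter E)

/-- The residual `ξ_k` of `ξ` after removing its `k` leading directions along `U`. -/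
def flagRes : ℕ → E → E
  | 0 => id
  | k + 1 => fun ξ => flagRes k ξ
      - ⟪limUnder U (fun ξ => ‖flagRes k ξ‖⁻¹ • flagRes k ξ), flagRes k ξ⟫ •
        limUnder U (fun ξ => ‖flagRes k ξ‖⁻¹ • flagRes k ξ)

/-- The direction of the `k`-th residual: the limit of `ξ_k / |ξ_k|`. -/
def flagDir (k : ℕ) : E := limUnder U (fun ξ => ‖flagRes U k ξ‖⁻¹ • flagRes U k ξ)

lemma flagRes_succ (k : ℕ) (ξ : E) : flagRes U (k + 1) ξ
    = flagRes U k ξ - ⟪flagDir U k, flagRes U k ξ⟫ • flagDir U k := rfl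

/-- The growth of the `k`-th residual: `|ξ_k|² / |ξ|`. -/
def flagGrowth (k : ℕ) (ξ : E) : ℝ := ‖flagRes U k ξ‖ ^ 2 / ‖ξ‖

lemma flagGrowth_nonneg (k : ℕ) (ξ : E) : 0 ≤ flagGrowth U k ξ := by
  unfold flagGrowth
  positivity

lemma eventually_flagRes_ne_zero {k : ℕ} (h : ¬ Tendsto (flagGrowth U k) U (𝓝 0)) :
    ∀ᶠ ξ in (U : Filter E), flagRes U k ξ ≠ 0 := by
  rcases U.em (fun ξ => flagRes U k ξ = 0) with h1 | h1
  · refine absurd (tendsto_const_nhds.congr' ?_) h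
    filter_upwards [h1] with ξ hξ
    simp [flagGrowth, hξ]
  · exact h1

/-- An ultrafilter decides every inequality, so failure of convergence to 0 becomes an eventual
lower bound rather than a frequent one. -/
lemma exists_eventually_le_of_not_tendsto {α : Type*} {l : Ultrafilter α} {q : α → ℝ} (hq : ∀ ξ, 0 ≤ q ξ)
    (h : ¬ Tendsto q l (𝓝 0)) : ∃ c > 0, ∀ᶠ ξ in (l : Filter α), c ≤ q ξ := by
  by_contra! hc
  refine h (Metric.tendsto_nhds.2 fun ε hε => ?_)
  filter_upwards [hc ε hε] with ξ hξ
  rwa [Real.dist_eq, sub_zero, abs_of_nonneg (hq ξ)]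

lemma exists_eventually_ge_of_not_tendsto_atTop {α : Type*} {l : Ultrafilter α} {q : α → ℝ}
    (h : ¬ Tendsto q l atTop) : ∃ B, ∀ᶠ ξ in (l : Filter α), q ξ ≤ B := by
  by_contra! hc
  refine h (tendsto_atTop.2 fun B => ?_)
  filter_upwards [hc B] with ξ hξ using hξ.le

lemma sub_flagRes_mem (k : ℕ) {X : Submodule ℝ E} (h : ∀ j < k, flagDir U j ∈ X) (ξ : E) :
    ξ - flagRes U k ξ ∈ X := by
  induction k with
  | zero => simp [flagRes]
  | succ k ih =>
    rw [flagRes_succ, ← sub_add]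
    exact X.add_mem (ih fun j hj => h j (by omega)) (X.smul_mem _ (h k (by omega)))

variable [FiniteDimensional ℝ E]

/-- The normalized residuals stay in the compact unit ball, also where the residual vanishes, since
then the normalization is 0. Every `limUnder` in the recursion is therefore a true limit. -/
lemma tendsto_flagDir (k : ℕ) :
    Tendsto (fun ξ => ‖flagRes U k ξ‖⁻¹ • flagRes U k ξ) U (𝓝 (flagDir U k)) := by
  refine tendsto_nhds_limUnder ?_
  obtain ⟨x, -, hx⟩ := (isCompact_closedBall (0 : E) 1).ultrafilter_le_nhds
    (U.map fun ξ => ‖flagRes U k ξ‖⁻¹ • flagRes U k ξ) (by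
      refine le_principal_iff.2 (mem_map.2 (Eventually.of_forall fun ξ => ?_))
      change ‖flagRes U k ξ‖⁻¹ • flagRes U k ξ ∈ Metric.closedBall (0 : E) 1
      rw [mem_closedBall_zero_iff, norm_smul, norm_inv, norm_norm]
      exact inv_mul_le_one)
  exact ⟨x, hx⟩

lemma norm_flagDir_of_eventually_ne {k : ℕ} (h : ∀ᶠ ξ in (U : Filter E), flagRes U k ξ ≠ 0) :
    ‖flagDir U k‖ = 1 := by
  refine tendsto_nhds_unique (tendsto_flagDir U k).norm (tendsto_const_nhds.congr' ?_)
  filter_upwards [h] with ξ hξ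
  rw [norm_smul, norm_inv, norm_norm, inv_mul_cancel₀ (norm_ne_zero_iff.2 hξ)]

lemma flagDir_eq_zero_or (k : ℕ) : flagDir U k = 0 ∨ ‖flagDir U k‖ = 1 := by
  rcases U.em (fun ξ => flagRes U k ξ = 0) with h | h
  · left
    refine tendsto_nhds_unique (tendsto_flagDir U k) (tendsto_const_nhds.congr' ?_)
    filter_upwards [h] with ξ hξ
    rw [hξ, smul_zero]
  · exact Or.inr (norm_flagDir_of_eventually_ne U h)

lemma inner_flagDir_self_smul (k : ℕ) : ⟪flagDir U k, flagDir U k⟫ • flagDir U k = flagDir U k := by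
  rcases flagDir_eq_zero_or U k with h | h
  · rw [h, smul_zero]
  · rw [real_inner_self_eq_norm_sq, h, one_pow, one_smul]

lemma inner_flagDir_flagRes (k : ℕ) : ∀ j < k, ∀ ξ, ⟪flagDir U j, flagRes U k ξ⟫ = 0 := by
  induction k with
  | zero => intro j hj; omega
  | succ k ih =>
    intro j hj ξ
    rw [flagRes_succ, inner_sub_right, inner_smul_right]
    rcases Nat.lt_succ_iff_lt_or_eq.1 hj with h | rfl
    · have h0 : ⟪flagDir U j, flagDir U k⟫ = 0 := by
        refine tendsto_nhds_unique (Tendsto.inner tendsto_const_nhds (tendsto_flagDir U k)) ?_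
        simp only [inner_smul_right, ih j h, mul_zero]
        exact tendsto_const_nhds
      rw [ih j h, h0, mul_zero, sub_zero]
    · rcases flagDir_eq_zero_or U j with h | h
      · simp [h]
      · rw [real_inner_self_eq_norm_sq, h, one_pow, mul_one, sub_self]

lemma inner_flagDir_flagDir {j k : ℕ} (h : j < k) : ⟪flagDir U j, flagDir U k⟫ = 0 := by
  refine tendsto_nhds_unique (Tendsto.inner tendsto_const_nhds (tendsto_flagDir U k)) ?_
  simp only [inner_smul_right, inner_flagDir_flagRes U k j h, mul_zero]
  exact tendsto_const_nhds

lemma orthonormal_flagDir {ι : Type*} {g : ι → ℕ} (hg : Function.Injective g)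
    (h : ∀ i, ∀ᶠ ξ in (U : Filter E), flagRes U (g i) ξ ≠ 0) :
    Orthonormal ℝ fun i => flagDir U (g i) := by
  refine ⟨fun i => norm_flagDir_of_eventually_ne U (h i), fun i j hij => ?_⟩
  rcases lt_or_gt_of_ne (hg.ne hij) with h | h
  · exact inner_flagDir_flagDir U h
  · rw [real_inner_comm]
    exact inner_flagDir_flagDir U h

/-- After division by |ξ_k|, the next residual is a unit vector minus its component along its own
limit. -/
lemma tendsto_flagRes_succ_div (k : ℕ) :
    Tendsto (fun ξ => ‖flagRes U (k + 1) ξ‖ / ‖flagRes U k ξ‖) U (𝓝 0) := by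
  have h := tendsto_flagDir U k
  have h1 := (h.sub ((Tendsto.inner (𝕜 := ℝ) (tendsto_const_nhds (x := flagDir U k)) h).smul_const (flagDir U k))).norm
  rw [inner_flagDir_self_smul, sub_self, norm_zero] at h1
  refine h1.congr fun ξ => ?_
  rw [inner_smul_right, ← smul_smul, ← smul_sub, ← flagRes_succ, norm_smul, norm_inv, norm_norm,
    div_eq_inv_mul]

/-- Otherwise no residual would degenerate and the directions would form an infinite orthonormal
system in finite dimension. -/
lemma exists_tendsto_flagGrowth : ∃ k, Tendsto (flagGrowth U k) U (𝓝 0) := by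
  by_contra! h
  have ho := orthonormal_flagDir U (g := (id : ℕ → ℕ)) Function.injective_id fun i =>
    eventually_flagRes_ne_zero U (h i)
  exact not_finite_iff_infinite.2 (inferInstance : Infinite ℕ)
    (LinearIndependent.finite ho.linearIndependent)

/-- The k-th growth is the next one times (|ξ_k|/|ξ_{k+1}|)² → ∞. This is the source of d ∈ {m - 1,
m}. -/
lemma tendsto_flagGrowth_atTop_of_succ {k : ℕ} (h : ¬ Tendsto (flagGrowth U (k + 1)) U (𝓝 0)) :
    Tendsto (flagGrowth U k) U atTop := by
  obtain ⟨c, hc, hle⟩ := exists_eventually_le_of_not_tendsto (flagGrowth_nonneg U (k + 1)) h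
  have h0 : Tendsto (fun ξ => (‖flagRes U (k + 1) ξ‖ / ‖flagRes U k ξ‖) ^ 2) U (𝓝[>] 0) := by
    refine tendsto_nhdsWithin_iff.2 ⟨by simpa using (tendsto_flagRes_succ_div U k).pow 2, ?_⟩
    filter_upwards [eventually_flagRes_ne_zero U h] with ξ hξ
    have h1 : flagRes U k ξ ≠ 0 := fun h1 => hξ (by rw [flagRes_succ, h1]; simp)
    exact pow_pos (div_pos (norm_pos_iff.2 hξ) (norm_pos_iff.2 h1)) 2
  refine tendsto_atTop_mono' _ ?_ ((tendsto_inv_nhdsGT_zero.comp h0).const_mul_atTop hc)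
  filter_upwards [hle, eventually_flagRes_ne_zero U h] with ξ h1 h2
  have h3 : flagRes U k ξ ≠ 0 := fun h3 => h2 (by rw [flagRes_succ, h3]; simp)
  have h4 : 0 < ‖flagRes U (k + 1) ξ‖ := norm_pos_iff.2 h2
  have h5 : 0 < ‖flagRes U k ξ‖ := norm_pos_iff.2 h3
  calc c * ((‖flagRes U (k + 1) ξ‖ / ‖flagRes U k ξ‖) ^ 2)⁻¹
      ≤ flagGrowth U (k + 1) ξ * ((‖flagRes U (k + 1) ξ‖ / ‖flagRes U k ξ‖) ^ 2)⁻¹ := by gcongr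
    _ = flagGrowth U k ξ := by
      unfold flagGrowth
      field_simp

lemma tendsto_flagGrowth_zero (hU : (U : Filter E) ≤ cocompact E) :
    Tendsto (flagGrowth U 0) U atTop := by
  refine ((tendsto_norm_cocompact_atTop (E := E)).mono_left hU).congr fun ξ => ?_
  rw [flagGrowth]
  rcases eq_or_ne ‖ξ‖ 0 with h | h
  · simp [h]
  · simp only [flagRes, id_eq]
    field_simp

end Flag

/-! ### Reading the two parts of a limit point from asymptotic ratios -/

section Limits

open Filter Topology

variable {n : ℕ} {l : Filter (Rn n)} {X : Submodule ℝ (Rn n)} {s : Rn n}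

/-- Two nonnegative rescalings of one family satisfy |b y| a y = |a y| b y; the relation survives in
the limit. -/
lemma coDirected_of_tendsto {α : Type*} {l : Filter α} [l.NeBot] {y : α → Rn n} {a b : α → ℝ}
    (ha : ∀ x, 0 ≤ a x) (hb : ∀ x, 0 ≤ b x) {u v : Rn n} (hu : u ≠ 0) (hv : v ≠ 0)
    (hau : Tendsto (fun x => a x • y x) l (𝓝 u)) (hbv : Tendsto (fun x => b x • y x) l (𝓝 v)) :
    CoDirected u v := by
  have h : ‖v‖ • u = ‖u‖ • v := by
    refine tendsto_nhds_unique (hbv.norm.smul hau) ((hau.norm.smul hbv).congr fun x => ?_)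
    rw [norm_smul, norm_smul, Real.norm_of_nonneg (ha x), Real.norm_of_nonneg (hb x), smul_smul,
      smul_smul]
    congr 1
    ring
  refine ⟨hu, hv, ‖u‖ / ‖v‖, by positivity, ?_⟩
  rw [div_eq_inv_mul, ← smul_smul, ← h, smul_smul, inv_mul_cancel₀ (norm_ne_zero_iff.2 hv),
    one_smul]

lemma tendsto_starProjection_anisoProj (ht : Tendsto (anisoProj X) l (𝓝 s)) :
    Tendsto (fun ξ => (anisoWeight X ξ ^ (1 / 2 : ℝ))⁻¹ • X.starProjection ξ) l
      (𝓝 (X.starProjection s)) :=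
  ((X.starProjection.continuous.tendsto s).comp ht).congr fun ξ =>
    starProjection_smul_add_smul X _ _ ξ

lemma tendsto_starProjection_orthogonal_anisoProj (ht : Tendsto (anisoProj X) l (𝓝 s)) :
    Tendsto (fun ξ => (anisoWeight X ξ ^ (1 / 4 : ℝ))⁻¹ • Xᗮ.starProjection ξ) l
      (𝓝 (Xᗮ.starProjection s)) :=
  ((Xᗮ.starProjection.continuous.tendsto s).comp ht).congr fun ξ =>
    starProjection_orthogonal_smul_add_smul X _ _ ξ

/-- The share of the weight carried by ξ̃; together with the share of ξ̄ it reduces vanishing of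
either part of the limit to a ratio of norms. -/
lemma tendsto_norm_sq_div_anisoWeight (ht : Tendsto (anisoProj X) l (𝓝 s)) :
    Tendsto (fun ξ => ‖X.starProjection ξ‖ ^ 2 / anisoWeight X ξ) l
      (𝓝 (‖X.starProjection s‖ ^ 2)) := by
  refine ((tendsto_starProjection_anisoProj ht).norm.pow 2).congr fun ξ => ?_
  have hw := anisoWeight_nonneg X ξ
  rw [norm_smul, mul_pow, norm_inv, inv_pow, Real.norm_of_nonneg (by positivity),
    ← Real.rpow_natCast, ← Real.rpow_mul hw, div_eq_inv_mul]
  norm_num [div_eq_inv_mul]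

lemma tendsto_norm_pow_div_anisoWeight (ht : Tendsto (anisoProj X) l (𝓝 s)) :
    Tendsto (fun ξ => ‖Xᗮ.starProjection ξ‖ ^ 4 / anisoWeight X ξ) l
      (𝓝 (‖Xᗮ.starProjection s‖ ^ 4)) := by
  refine ((tendsto_starProjection_orthogonal_anisoProj ht).norm.pow 4).congr fun ξ => ?_
  have hw := anisoWeight_nonneg X ξ
  rw [norm_smul, mul_pow, norm_inv, inv_pow, Real.norm_of_nonneg (by positivity),
    ← Real.rpow_natCast, ← Real.rpow_mul hw, div_eq_inv_mul]
  norm_num [div_eq_inv_mul]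

lemma tendsto_div_of_tilde_eq_zero (ht : Tendsto (anisoProj X) l (𝓝 s)) (hs : s ∈ anisoSphere X)
    (h : X.starProjection s = 0) :
    Tendsto (fun ξ => ‖X.starProjection ξ‖ ^ 2 / ‖Xᗮ.starProjection ξ‖ ^ 4) l (𝓝 0) := by
  have hs' : ‖X.starProjection s‖ ^ 2 + ‖Xᗮ.starProjection s‖ ^ 4 = 1 := hs
  have h1 := tendsto_norm_sq_div_anisoWeight ht
  have h2 := tendsto_norm_pow_div_anisoWeight ht
  rw [h, norm_zero, zero_pow two_ne_zero] at h1 hs'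
  rw [zero_add] at hs'
  rw [hs'] at h2
  have h3 := h1.div h2 one_ne_zero
  rw [zero_div] at h3
  refine h3.congr' ?_
  filter_upwards [h2.eventually_ne one_ne_zero] with ξ hξ
  exact div_div_div_cancel_right₀ (fun h0 => hξ (by rw [h0, div_zero])) _ _

lemma tendsto_div_of_bar_eq_zero (ht : Tendsto (anisoProj X) l (𝓝 s)) (hs : s ∈ anisoSphere X)
    (h : Xᗮ.starProjection s = 0) :
    Tendsto (fun ξ => ‖Xᗮ.starProjection ξ‖ ^ 4 / ‖ξ‖ ^ 2) l (𝓝 0) := by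
  have hs' : ‖X.starProjection s‖ ^ 2 + ‖Xᗮ.starProjection s‖ ^ 4 = 1 := hs
  have h1 := tendsto_norm_sq_div_anisoWeight ht
  have h2 := tendsto_norm_pow_div_anisoWeight ht
  rw [h, norm_zero, zero_pow four_ne_zero] at h2 hs'
  rw [add_zero] at hs'
  rw [hs'] at h1
  have h3 := h2.div h1 one_ne_zero
  rw [zero_div] at h3
  refine squeeze_zero' (Eventually.of_forall fun ξ => by positivity) ?_ h3
  filter_upwards [h1.eventually_ne one_ne_zero] with ξ hξ
  have hw : anisoWeight X ξ ≠ 0 := fun h0 => hξ (by rw [h0, div_zero])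
  have hP : 0 < ‖X.starProjection ξ‖ := by
    refine (norm_nonneg _).lt_of_ne' fun h0 => hξ (by rw [h0]; simp)
  rw [Pi.div_apply, div_div_div_cancel_right₀ hw]
  gcongr
  exact X.norm_starProjection_apply_le ξ

variable [l.NeBot]

lemma bar_eq_zero_of_tendsto (ht : Tendsto (anisoProj X) l (𝓝 s))
    (hP : ∀ᶠ ξ in l, X.starProjection ξ ≠ 0)
    (h : Tendsto (fun ξ => ‖Xᗮ.starProjection ξ‖ ^ 4 / ‖X.starProjection ξ‖ ^ 2) l (𝓝 0)) :
    Xᗮ.starProjection s = 0 := by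
  have h2 := tendsto_nhds_unique (tendsto_norm_pow_div_anisoWeight ht)
    (squeeze_zero' (Eventually.of_forall fun ξ =>
      div_nonneg (by positivity) (anisoWeight_nonneg X ξ)) (by
        filter_upwards [hP] with ξ hξ
        have := norm_pos_iff.2 hξ
        unfold anisoWeight
        gcongr
        exact le_add_of_nonneg_right (by positivity)) h)
  simpa using h2

lemma tilde_eq_zero_of_tendsto (ht : Tendsto (anisoProj X) l (𝓝 s))
    (hQ : ∀ᶠ ξ in l, Xᗮ.starProjection ξ ≠ 0)
    (h : Tendsto (fun ξ => ‖X.starProjection ξ‖ ^ 2 / ‖Xᗮ.starProjection ξ‖ ^ 4) l (𝓝 0)) :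
    X.starProjection s = 0 := by
  have h2 := tendsto_nhds_unique (tendsto_norm_sq_div_anisoWeight ht)
    (squeeze_zero' (Eventually.of_forall fun ξ =>
      div_nonneg (by positivity) (anisoWeight_nonneg X ξ)) (by
        filter_upwards [hQ] with ξ hξ
        have := norm_pos_iff.2 hξ
        unfold anisoWeight
        gcongr
        exact le_add_of_nonneg_left (by positivity)) h)
  simpa using h2

end Limits

/-! ### Existence of the adapted system -/

section Existence

open Filter Topology

variable {n : ℕ} {U : Ultrafilter (Rn n)} {X : Submodule ℝ (Rn n)} {s : Rn n} {k : ℕ}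

lemma starProjection_orthogonal_ne_zero {v : Rn n} (hv : v ∉ X) : Xᗮ.starProjection v ≠ 0 := by
  rw [Ne, Submodule.starProjection_apply_eq_zero_iff, Submodule.orthogonal_orthogonal]
  exact hv

/-- The vector ξ - ξ_k is a combination of the first k directions, hence lies in X, so ξ and ξ_k
have the same projection on X^⊥. -/
lemma tendsto_bar_flagRes (hk : ∀ j < k, flagDir U j ∈ X) :
    Tendsto (fun ξ => ‖flagRes U k ξ‖⁻¹ • Xᗮ.starProjection ξ) U
      (𝓝 (Xᗮ.starProjection (flagDir U k))) := by
  refine ((Xᗮ.starProjection.continuous.tendsto _).comp (tendsto_flagDir U k)).congr fun ξ => ?_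
  have h : Xᗮ.starProjection (ξ - flagRes U k ξ) = 0 := by
    rw [Submodule.starProjection_apply_eq_zero_iff, Submodule.orthogonal_orthogonal]
    exact sub_flagRes_mem U k hk ξ
  rw [map_sub, sub_eq_zero] at h
  rw [Function.comp_apply, map_smul, h]

lemma tendsto_norm_bar_flagRes (hk : ∀ j < k, flagDir U j ∈ X) :
    Tendsto (fun ξ => ‖Xᗮ.starProjection ξ‖ / ‖flagRes U k ξ‖) U
      (𝓝 ‖Xᗮ.starProjection (flagDir U k)‖) := by
  refine (tendsto_bar_flagRes hk).norm.congr fun ξ => ?_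
  rw [norm_smul, norm_inv, norm_norm, div_eq_inv_mul]

lemma tendsto_tilde_div_norm (h : flagDir U 0 ∈ X) :
    Tendsto (fun ξ => ‖ξ‖⁻¹ • X.starProjection ξ) U (𝓝 (flagDir U 0)) := by
  have := (X.starProjection.continuous.tendsto _).comp (tendsto_flagDir U 0)
  rw [Submodule.starProjection_eq_self_iff.2 h] at this
  exact this.congr fun ξ => by simp [flagRes]

lemma eventually_ne_zero (hU : (U : Filter (Rn n)) ≤ cocompact (Rn n)) :
    ∀ᶠ ξ in (U : Filter (Rn n)), ξ ≠ 0 := by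
  filter_upwards [hU ((tendsto_norm_cocompact_atTop (E := Rn n)).eventually_gt_atTop 0)] with ξ hξ
  exact norm_pos_iff.1 hξ

lemma tendsto_norm_tilde_div_norm (hU : (U : Filter (Rn n)) ≤ cocompact (Rn n))
    (h : flagDir U 0 ∈ X) : Tendsto (fun ξ => ‖X.starProjection ξ‖ / ‖ξ‖) U (𝓝 1) := by
  have h1 := (tendsto_tilde_div_norm h).norm
  rw [norm_flagDir_of_eventually_ne U (k := 0) (eventually_ne_zero hU)] at h1
  refine h1.congr fun ξ => ?_
  rw [norm_smul, norm_inv, norm_norm, div_eq_inv_mul]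

/-- If ξ̄_X vanished, then |ξ̄|⁴/|ξ|² → 0; as |ξ̄| is comparable to |ξ_k|, this would force the
growth to 0. -/
lemma bar_ne_zero (hU : (U : Filter (Rn n)) ≤ cocompact (Rn n))
    (ht : Tendsto (anisoProj X) U (𝓝 s)) (hs : s ∈ anisoSphere X)
    (hk : ∀ j < k, flagDir U j ∈ X) (hkX : flagDir U k ∉ X)
    (hg : ¬ Tendsto (flagGrowth U k) U (𝓝 0)) : Xᗮ.starProjection s ≠ 0 := by
  intro h
  have hc : ‖Xᗮ.starProjection (flagDir U k)‖ ≠ 0 :=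
    norm_ne_zero_iff.2 (starProjection_orthogonal_ne_zero hkX)
  have hq := tendsto_norm_bar_flagRes hk
  have h1 := (tendsto_div_of_bar_eq_zero ht hs h).div (hq.pow 4) (pow_ne_zero 4 hc)
  rw [zero_div] at h1
  have h2 := (Real.continuous_sqrt.tendsto 0).comp h1
  rw [Real.sqrt_zero] at h2
  refine hg (h2.congr' ?_)
  filter_upwards [eventually_flagRes_ne_zero U hg, hq.eventually_ne hc, eventually_ne_zero hU]
    with ξ hr hQ hξ
  have hr' := norm_ne_zero_iff.2 hr
  have hξ' := norm_ne_zero_iff.2 hξ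
  have hQ' : ‖Xᗮ.starProjection ξ‖ ≠ 0 := fun h0 => hQ (by rw [h0, zero_div])
  rw [Function.comp_apply, ← Real.sqrt_sq (flagGrowth_nonneg U k ξ), flagGrowth, Pi.div_apply]
  congr 1
  field_simp

/-- Here |ξ̃|²/|ξ̄|⁴ is bounded by a constant times the inverse square of the growth. No lower bound
on |ξ̃| is used, so k = 0 is included. -/
lemma tilde_eq_zero (ht : Tendsto (anisoProj X) U (𝓝 s))
    (hk : ∀ j < k, flagDir U j ∈ X) (hkX : flagDir U k ∉ X)
    (hg : Tendsto (flagGrowth U k) U atTop) : X.starProjection s = 0 := by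
  have hc : ‖Xᗮ.starProjection (flagDir U k)‖ ≠ 0 :=
    norm_ne_zero_iff.2 (starProjection_orthogonal_ne_zero hkX)
  have hq := tendsto_norm_bar_flagRes hk
  have h1 := ((tendsto_inv_atTop_zero.comp hg).pow 2).mul ((hq.inv₀ hc).pow 4)
  rw [zero_pow two_ne_zero, zero_mul] at h1
  have hQ : ∀ᶠ ξ in (U : Filter (Rn n)), Xᗮ.starProjection ξ ≠ 0 := by
    filter_upwards [hq.eventually_ne hc] with ξ hξ h0
    exact hξ (by rw [h0, norm_zero, zero_div])
  refine tilde_eq_zero_of_tendsto ht hQ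
    (squeeze_zero' (Eventually.of_forall fun ξ => by positivity) ?_ h1)
  filter_upwards [hQ, hg.eventually_gt_atTop 0] with ξ hQ hgξ
  have hQ' := norm_ne_zero_iff.2 hQ
  have hr' : ‖flagRes U k ξ‖ ≠ 0 := fun h0 => hgξ.ne' (by rw [flagGrowth, h0]; simp)
  have e : (flagGrowth U k ξ)⁻¹ ^ 2 * (‖Xᗮ.starProjection ξ‖ / ‖flagRes U k ξ‖)⁻¹ ^ 4
      = ‖ξ‖ ^ 2 / ‖Xᗮ.starProjection ξ‖ ^ 4 := by
    rw [flagGrowth]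
    field_simp
  rw [Function.comp_apply, e]
  gcongr
  exact X.norm_starProjection_apply_le ξ

/-- The condition k > 0 puts ζ_1 in X, whence |ξ̃| ~ |ξ|. A growth bounded by B then keeps the
corrected ratio |ξ̃|²/|ξ̄|⁴ above B⁻². -/
lemma tilde_ne_zero (hU : (U : Filter (Rn n)) ≤ cocompact (Rn n))
    (ht : Tendsto (anisoProj X) U (𝓝 s)) (hs : s ∈ anisoSphere X)
    (hk : ∀ j < k, flagDir U j ∈ X) (h0 : 0 < k) (hkX : flagDir U k ∉ X)
    (hg : ¬ Tendsto (flagGrowth U k) U (𝓝 0)) (hg' : ¬ Tendsto (flagGrowth U k) U atTop) :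
    X.starProjection s ≠ 0 := by
  intro h
  have hc : ‖Xᗮ.starProjection (flagDir U k)‖ ≠ 0 :=
    norm_ne_zero_iff.2 (starProjection_orthogonal_ne_zero hkX)
  have hq := tendsto_norm_bar_flagRes hk
  have hp := tendsto_norm_tilde_div_norm hU (hk 0 h0)
  obtain ⟨B, hB⟩ := exists_eventually_ge_of_not_tendsto_atTop hg'
  have h1 := ((tendsto_div_of_tilde_eq_zero ht hs h).mul ((hp.inv₀ one_ne_zero).pow 2)).mul
    (hq.pow 4)
  rw [zero_mul, zero_mul] at h1
  have hgpos : ∀ᶠ ξ in (U : Filter (Rn n)), 0 < flagGrowth U k ξ := by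
    filter_upwards [eventually_flagRes_ne_zero U hg, eventually_ne_zero hU] with ξ hr hξ
    exact div_pos (pow_pos (norm_pos_iff.2 hr) 2) (norm_pos_iff.2 hξ)
  obtain ⟨ξ₀, hξ₀, hξ₀'⟩ := (hgpos.and hB).exists
  have hB0 : 0 < B := hξ₀.trans_le hξ₀'
  refine absurd (ge_of_tendsto h1 (b := (B ^ 2)⁻¹) ?_) (not_le.2 (by positivity))
  filter_upwards [eventually_flagRes_ne_zero U hg, eventually_ne_zero hU, hB, hgpos,
    hq.eventually_ne hc, hp.eventually_ne one_ne_zero] with ξ hr hξ hBξ hgξ hQ hP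
  have hr' := norm_ne_zero_iff.2 hr
  have hξ' := norm_ne_zero_iff.2 hξ
  have hQ' : ‖Xᗮ.starProjection ξ‖ ≠ 0 := fun h0 => hQ (by rw [h0, zero_div])
  have hP' : ‖X.starProjection ξ‖ ≠ 0 := fun h0 => hP (by rw [h0, zero_div])
  have e : ‖X.starProjection ξ‖ ^ 2 / ‖Xᗮ.starProjection ξ‖ ^ 4
      * (‖X.starProjection ξ‖ / ‖ξ‖)⁻¹ ^ 2 * (‖Xᗮ.starProjection ξ‖ / ‖flagRes U k ξ‖) ^ 4
      = (flagGrowth U k ξ ^ 2)⁻¹ := by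
    rw [flagGrowth]
    field_simp
  rw [e]
  gcongr

lemma bar_eq_zero (hU : (U : Filter (Rn n)) ≤ cocompact (Rn n))
    (ht : Tendsto (anisoProj X) U (𝓝 s)) (hk : ∀ j < k, flagDir U j ∈ X) (h0 : 0 < k)
    (hg : Tendsto (flagGrowth U k) U (𝓝 0)) : Xᗮ.starProjection s = 0 := by
  have hp := tendsto_norm_tilde_div_norm hU (hk 0 h0)
  have h1 := (hg.pow 2).mul ((hp.inv₀ one_ne_zero).pow 2)
  rw [zero_pow two_ne_zero, zero_mul] at h1
  have hP : ∀ᶠ ξ in (U : Filter (Rn n)), X.starProjection ξ ≠ 0 := by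
    filter_upwards [hp.eventually_ne one_ne_zero] with ξ hξ h0
    exact hξ (by rw [h0, norm_zero, zero_div])
  refine bar_eq_zero_of_tendsto ht hP
    (squeeze_zero' (Eventually.of_forall fun ξ => by positivity) ?_ h1)
  filter_upwards [hP, eventually_ne_zero hU] with ξ hP hξ
  have hP' := norm_ne_zero_iff.2 hP
  have hξ' := norm_ne_zero_iff.2 hξ
  have e : flagGrowth U k ξ ^ 2 * (‖X.starProjection ξ‖ / ‖ξ‖)⁻¹ ^ 2
      = ‖flagRes U k ξ‖ ^ 4 / ‖X.starProjection ξ‖ ^ 2 := by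
    rw [flagGrowth]
    field_simp
  have h : Xᗮ.starProjection (ξ - flagRes U k ξ) = 0 := by
    rw [Submodule.starProjection_apply_eq_zero_iff, Submodule.orthogonal_orthogonal]
    exact sub_flagRes_mem U k hk ξ
  rw [map_sub, sub_eq_zero] at h
  rw [e, h]
  gcongr
  exact Xᗮ.norm_starProjection_apply_le _

lemma exists_first_notMem {z : ℕ → Rn n} {N : ℕ} (h : ¬ ∀ j < N, z j ∈ X) :
    ∃ k < N, z k ∉ X ∧ ∀ j < k, z j ∈ X := by
  classical
  push Not at h
  have h' : ∃ j, z j ∉ X := h.imp fun j hj => hj.2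
  obtain ⟨j, hj, hjX⟩ := h
  exact ⟨Nat.find h', (Nat.find_min' h' hjX).trans_lt hj, Nat.find_spec h',
    fun i hi => not_not.1 (Nat.find_min h' hi)⟩

theorem exists_isAdapted (hU : (U : Filter (Rn n)) ≤ cocompact (Rn n))
    (p : (X : Submodule ℝ (Rn n)) → anisoSphere X)
    (hp : ∀ X, Tendsto (anisoProj X) U (𝓝 (p X : Rn n))) :
    ∃ (m : ℕ) (ζ : Fin m → Rn n) (d : ℕ), IsAdapted p ζ d := by
  classical
  have hex := exists_tendsto_flagGrowth U
  obtain ⟨m, hm, hmin⟩ : ∃ m, Tendsto (flagGrowth U m) U (𝓝 0) ∧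
      ∀ k < m, ¬ Tendsto (flagGrowth U k) U (𝓝 0) :=
    ⟨Nat.find hex, Nat.find_spec hex, fun k hk => Nat.find_min hex hk⟩
  have hinf0 := tendsto_flagGrowth_zero U hU
  have hm0 : 0 < m := by
    rcases Nat.eq_zero_or_pos m with rfl | h
    · exact absurd hm (not_tendsto_nhds_of_tendsto_atTop hinf0 0)
    · exact h
  have hinf : ∀ k, k + 1 < m → Tendsto (flagGrowth U k) U atTop := fun k hk =>
    tendsto_flagGrowth_atTop_of_succ U (hmin (k + 1) hk)
  -- Only the last index m - 1 is undecided: its growth either tends to infinity (d = m) or stays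
  -- bounded (d = m - 1).
  obtain ⟨d, hd, hd1, hd2⟩ : ∃ d, (d = m ∨ d + 1 = m) ∧
      (∀ k < d, Tendsto (flagGrowth U k) U atTop) ∧
      ∀ k, d ≤ k → k < m → ¬ Tendsto (flagGrowth U k) U atTop := by
    by_cases h : Tendsto (flagGrowth U (m - 1)) U atTop
    · refine ⟨m, Or.inl rfl, fun k hk => ?_, fun k h1 h2 => absurd h1 (not_le.2 h2)⟩
      rcases eq_or_ne k (m - 1) with rfl | hne
      · exact h
      · exact hinf k (by omega)
    · refine ⟨m - 1, Or.inr (by omega), fun k hk => hinf k (by omega), fun k h1 h2 => ?_⟩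
      rwa [show k = m - 1 by omega]
  have hdm : d ≤ m := by omega
  have hspan : ∀ X : Submodule ℝ (Rn n), Submodule.span ℝ
      ((fun k : Fin m => flagDir U k) '' {k : Fin m | (k : ℕ) < d}) ≤ X ↔
      ∀ j < d, flagDir U j ∈ X := fun X => by
    rw [Submodule.span_le, Set.image_subset_iff]
    exact ⟨fun h j hj => h (a := ⟨j, hj.trans_le hdm⟩) hj, fun h k hk => h k hk⟩
  have hspan' : ∀ X : Submodule ℝ (Rn n), Submodule.span ℝ
      (Set.range fun k : Fin m => flagDir U k) ≤ X ↔ ∀ j < m, flagDir U j ∈ X := fun X => by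
    rw [Submodule.span_le, Set.range_subset_iff]
    exact ⟨fun h j hj => h ⟨j, hj⟩, fun h k => h k k.2⟩
  have htilde : ∀ X : Submodule ℝ (Rn n), X.starProjection (p X : Rn n) ≠ 0 →
      ∀ j < d, flagDir U j ∈ X := by
    intro X hX
    by_contra hj
    obtain ⟨k, hk, hkX, hkj⟩ := exists_first_notMem hj
    exact hX (tilde_eq_zero (hp X) hkj hkX (hd1 k hk))
  -- The zeroth growth is |ξ| → ∞, so containing the first d directions includes containing ζ_1.
  have hd0 : 0 < d := by
    by_contra h
    exact hd2 0 (by omega) hm0 hinf0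
  have hbar : ∀ X : Submodule ℝ (Rn n), (∀ j < m, flagDir U j ∈ X) →
      Xᗮ.starProjection (p X : Rn n) = 0 := fun X hX => bar_eq_zero hU (hp X) hX hm0 hm
  refine ⟨m, fun k => flagDir U k, d, ?_, hd, ?_, ?_, ?_, ?_⟩
  · exact orthonormal_flagDir U Fin.val_injective fun i =>
      eventually_flagRes_ne_zero U (hmin i i.2)
  · intro X
    rw [hspan]
    refine ⟨htilde X, fun h => ?_⟩
    -- If X contains every direction, the bar part is zero, and a point of S_X cannot have both
    -- parts zero.
    by_cases hall : ∀ j < m, flagDir U j ∈ X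
    · intro h0
      have hs : ‖X.starProjection (p X : Rn n)‖ ^ 2 + ‖Xᗮ.starProjection (p X : Rn n)‖ ^ 4 = 1 :=
        (p X).2
      rw [h0, hbar X hall] at hs
      norm_num at hs
    · obtain ⟨k, hk, hkX, hkj⟩ := exists_first_notMem hall
      have hdk : d ≤ k := not_lt.1 fun hlt => hkX (h k hlt)
      exact tilde_ne_zero hU (hp X) (p X).2 hkj (hd0.trans_le hdk) hkX (hmin k hk) (hd2 k hdk hk)
  · intro X hX
    have h0 := htilde X hX 0 hd0
    refine ⟨hm0, coDirected_of_tendsto (fun ξ => ?_) (fun ξ => inv_nonneg.2 (norm_nonneg ξ)) hX ?_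
      (tendsto_starProjection_anisoProj (hp X)) (tendsto_tilde_div_norm h0)⟩
    · exact inv_nonneg.2 (Real.rpow_nonneg (anisoWeight_nonneg X ξ) _)
    · rw [← norm_ne_zero_iff, norm_flagDir_of_eventually_ne U (k := 0) (eventually_ne_zero hU)]
      exact one_ne_zero
  · intro X
    rw [hspan']
    refine ⟨fun h hall => h (hbar X hall), fun hall => ?_⟩
    obtain ⟨k, hk, hkX, hkj⟩ := exists_first_notMem hall
    exact bar_ne_zero hU (hp X) (p X).2 hkj hkX (hmin k hk)
  · intro X hX
    have hall : ¬ ∀ j < m, flagDir U j ∈ X := fun hall => hX (hbar X hall)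
    obtain ⟨k, hk, hkX, hkj⟩ := exists_first_notMem hall
    refine ⟨⟨k, hk⟩, ⟨hkX, fun j hj => not_lt.1 fun hlt => hj (hkj j hlt)⟩, ?_⟩
    exact coDirected_of_tendsto
      (fun ξ => inv_nonneg.2 (Real.rpow_nonneg (anisoWeight_nonneg X ξ) _))
      (fun ξ => inv_nonneg.2 (norm_nonneg _)) hX (starProjection_orthogonal_ne_zero hkX)
      (tendsto_starProjection_orthogonal_anisoProj (hp X)) (tendsto_bar_flagRes hkj)

end Existence

/-! ### Uniqueness of the adapted system -/

section Uniqueness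

variable {n : ℕ} {p : (X : Submodule ℝ (Rn n)) → anisoSphere X}

lemma mem_orthogonal_span_image_lt {m : ℕ} {ζ : Fin m → Rn n} (h : Orthonormal ℝ ζ) (k : Fin m)
    {d : ℕ} (hd : d ≤ k) : ζ k ∈ (Submodule.span ℝ (ζ '' {j : Fin m | (j : ℕ) < d}))ᗮ := by
  rw [Submodule.mem_orthogonal]
  intro u hu
  induction hu using Submodule.span_induction with
  | mem x hx =>
    obtain ⟨j, hj, rfl⟩ := hx
    exact h.2 (by rintro rfl; exact absurd hj (not_lt.2 hd))
  | zero => exact inner_zero_left _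
  | add x y _ _ hx hy => rw [inner_add_left, hx, hy, add_zero]
  | smul a x _ hx => rw [inner_smul_left, hx, mul_zero]

lemma notMem_span_image_lt {m : ℕ} {ζ : Fin m → Rn n} (h : Orthonormal ℝ ζ) (k : Fin m)
    {d : ℕ} (hd : d ≤ k) : ζ k ∉ Submodule.span ℝ (ζ '' {j : Fin m | (j : ℕ) < d}) := by
  intro hk
  have h1 := Submodule.inner_right_of_mem_orthogonal hk (mem_orthogonal_span_image_lt h k hd)
  rw [inner_self_eq_zero] at h1
  exact h.ne_zero k h1

lemma IsAdapted.le {m : ℕ} {ζ : Fin m → Rn n} {d : ℕ} (h : IsAdapted p ζ d) : d ≤ m := by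
  rcases h.d_eq with h | h <;> omega

/-- Take for X the span of the preceding vectors: `ζ k` is the first one outside X and is orthogonal
to X, so the direction of ξ̄_X is `ζ k` itself. The system is thus recovered from `p` recursively.
-/
lemma IsAdapted.eq_smul {m : ℕ} {ζ : Fin m → Rn n} {d : ℕ} (h : IsAdapted p ζ d) (k : Fin m)
    {X : Submodule ℝ (Rn n)} (hX : X = Submodule.span ℝ (ζ '' {j : Fin m | (j : ℕ) < k})) :
    ζ k = ‖Xᗮ.starProjection (p X : Rn n)‖⁻¹ • Xᗮ.starProjection (p X : Rn n) := by
  have hk : ζ k ∈ Xᗮ := hX ▸ mem_orthogonal_span_image_lt h.orthonormal k le_rfl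
  have hk' : ζ k ∉ X := hX ▸ notMem_span_image_lt h.orthonormal k le_rfl
  have hne := (h.bar_iff X).2 fun hle => hk' (hle (Submodule.subset_span ⟨k, rfl⟩))
  obtain ⟨k', hleast, hcd⟩ := h.bar_dir X hne
  have hkl : IsLeast {k : Fin m | ζ k ∉ X} k :=
    ⟨hk', fun j hj => not_lt.1 fun hlt => hj (hX ▸ Submodule.subset_span ⟨j, hlt, rfl⟩)⟩
  rw [hleast.unique hkl, Submodule.starProjection_eq_self_iff.2 hk] at hcd
  obtain ⟨-, -, c, hc, e⟩ := hcd
  rw [e, norm_smul, h.orthonormal.1 k, mul_one, Real.norm_of_nonneg hc.le, smul_smul,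
    inv_mul_cancel₀ hc.ne', one_smul]

lemma IsAdapted.unique_family {m : ℕ} {ζ ζ' : Fin m → Rn n} {d d' : ℕ} (h : IsAdapted p ζ d)
    (h' : IsAdapted p ζ' d') : ζ = ζ' := by
  have key : ∀ N : ℕ, ∀ k : Fin m, (k : ℕ) = N → ζ k = ζ' k := by
    intro N
    induction N using Nat.strong_induction_on with
    | _ N ih =>
      rintro k rfl
      have e : ζ '' {j : Fin m | (j : ℕ) < k} = ζ' '' {j : Fin m | (j : ℕ) < k} :=
        Set.image_congr fun j hj => ih j hj j rfl
      rw [h.eq_smul k rfl, h'.eq_smul k (congrArg _ e)]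
  exact funext fun k => key k k rfl

/-- Testing on the span of the first d vectors: a larger d' would place the next vector in the span
of those orthogonal to it. -/
lemma IsAdapted.le_of_isAdapted {m : ℕ} {ζ : Fin m → Rn n} {d d' : ℕ} (h : IsAdapted p ζ d)
    (h' : IsAdapted p ζ d') : d' ≤ d := by
  by_contra! hlt
  have h1 : Submodule.span ℝ (ζ '' {j : Fin m | (j : ℕ) < d'})
      ≤ Submodule.span ℝ (ζ '' {j : Fin m | (j : ℕ) < d}) :=
    (h'.tilde_iff _).1 ((h.tilde_iff _).2 le_rfl)
  exact notMem_span_image_lt h.orthonormal ⟨d, hlt.trans_le h'.le⟩ le_rfl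
    (h1 (Submodule.subset_span ⟨_, hlt, rfl⟩))

lemma IsAdapted.span_le {m m' : ℕ} {ζ : Fin m → Rn n} {ζ' : Fin m' → Rn n} {d d' : ℕ}
    (h : IsAdapted p ζ d) (h' : IsAdapted p ζ' d') :
    Submodule.span ℝ (Set.range ζ) ≤ Submodule.span ℝ (Set.range ζ') := by
  by_contra hc
  exact (h'.bar_iff _).1 ((h.bar_iff _).2 hc) le_rfl

lemma IsAdapted.card_eq {m m' : ℕ} {ζ : Fin m → Rn n} {ζ' : Fin m' → Rn n} {d d' : ℕ}
    (h : IsAdapted p ζ d) (h' : IsAdapted p ζ' d') : m = m' := by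
  have h1 := finrank_span_eq_card h.orthonormal.linearIndependent
  have h2 := finrank_span_eq_card h'.orthonormal.linearIndependent
  rw [le_antisymm (h.span_le h') (h'.span_le h), h2] at h1
  simpa using h1.symm

end Uniqueness

end HSymbol

end

theorem proposition3 (n : ℕ) (η : HSymbol.SymbolSpectrum n) :
    ∃ p : (X : Submodule ℝ (HSymbol.Rn n)) → HSymbol.anisoSphere X,
      (∀ (X : Submodule ℝ (HSymbol.Rn n)) (s : HSymbol.anisoSphere X),
        HSymbol.IsSpectralProjection η X s ↔ s = p X) ∧
      ∃! q : (Σ m : ℕ, Fin m → HSymbol.Rn n) × ℕ, HSymbol.IsAdapted p q.1.2 q.2 := by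
  obtain ⟨p, hp, U, hU, hUp⟩ := HSymbol.exists_ultrafilter_of_spectrum η
  obtain ⟨m, ζ, d, h⟩ := HSymbol.exists_isAdapted hU p hUp
  refine ⟨p, hp, ⟨⟨m, ζ⟩, d⟩, h, ?_⟩
  rintro ⟨⟨m', ζ'⟩, d'⟩ h'
  -- The lengths are identified first, since the two families have types depending on them.
  obtain rfl : m = m' := h.card_eq h'
  obtain rfl : ζ = ζ' := h.unique_family h'
  exact Prod.ext rfl (le_antisymm (h.le_of_isAdapted h') (h'.le_of_isAdapted h))
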